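/- Let $X=(X_t)_{t\in\mathbb R}$ be a two-sided real-valued Lévy process on a probability space $(\Omega,\mathcal F,\mathbb P)$: its paths are càdlàg, its increments are independent and stationary, and $X_0=0$ almost surely. Suppose that $\mathbb E[X_1^+]<\infty$, so that $\mathbb E[X_1]\in[-\infty,\infty)$ is well defined, and let $\alpha\in\mathbb R$ with $\alpha>\mathbb E[X_1]$. Put $$L_t=\inf\{X_s+\alpha(t-s): s\le t\},\qquad \mathcal H_\alpha=\{t\in\mathbb R: X_t\wedge X_{t-}=L_t\},$$ which is a closed set. For a closed set $w\subseteq\mathbb R$ and $t\in\mathbb R$ let $d_t(w)=\inf\{s>t:s\in w\}$ (with $\inf\emptyset=+\infty$), $r_t(w)=d_t(w)-t$ and $\tau_t(w)=\mathrm{cl}\{s-t:s\in w,\ s>t\}$. Equip the set $\Omega^{\leftrightarrow}$ of closed subsets of $\mathbb R$ with $\mathcal G^{\leftrightarrow}=\sigma(r_s:s\in\mathbb R)$, put $\mathcal G_t^{\leftrightarrow}=\sigma(r_s:s\le t)$ and $\mathcal G^{\leftrightarrow}_{t+}=\bigcap_{u>t}\mathcal G^{\leftrightarrow}_u$, and equip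 the set $\Omega^{\to}$ of closed subsets of $[0,\infty)$ with the trace $\mathcal G^{\to}$ of $\mathcal G^{\leftrightarrow}$. Then: 1. $\mathcal H_\alpha$ is a random set, that is, it is a measurable map from $(\Omega,\mathcal F)$ to $(\Omega^{\leftrightarrow},\mathcal G^{\leftrightarrow})$. Let $\mathbb Q$ be its distribution. 2. $\mathcal H_\alpha$ is stationary: for every $u\in\mathbb R$, $u+\mathcal H_\alpha$ has the distribution $\mathbb Q$. 3. $\mathcal H_\alpha$ is regenerative (in the sense of Fitzsimmons and Taksar): $\mathbb Q\{d_t=+\infty\}=0$ for every $t\in\mathbb R$, and there is a probability measure $\mathbb Q^{\to}$ on $(\Omega^{\to},\mathcal G^{\to})$ such that for every $t\in\mathbb R$ and every $\mathcal G^{\leftrightarrow}$-measurable $F:\Omega^{\leftrightarrow}\to[0,\infty]$, $$\mathbb Q\big[F(\tau_{d_t})\,\big|\,\mathcal G^{\leftrightarrow}_{t+}\big]=\mathbb Q^{\to}[F]\qquad \mathbb Q\text{-almost surely.}$$ 4. Almost surely, $D:=\inf\{s>0:s\in\mathcal H_\alpha\}$ is finite and $X_D\le X_{D-}$. -/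

import Mathlib

open MeasureTheory ProbabilityTheory Filter Topology TopologicalSpace

noncomputable section

namespace RegenerativeSet

/-! ### Càdlàg paths and two-sided Lévy processes -/

/-- A path `f : ℝ → ℝ` is càdlàg: right-continuous with (finite) left limits at every point. -/
def IsCadlag (f : ℝ → ℝ) : Prop :=
  ∀ t : ℝ, ContinuousWithinAt f (Set.Ici t) t ∧ ∃ l : ℝ, Tendsto f (𝓝[<] t) (𝓝 l)

/-- `X = (X_t)_{t ∈ ℝ}` is a two-sided real-valued Lévy process under `P`: càdlàg paths,
independent and stationary increments, started from `0` at time `0`. -/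
structure IsTwoSidedLevyProcess {Ω : Type*} [MeasurableSpace Ω] (X : ℝ → Ω → ℝ)
    (P : Measure Ω) : Prop where
  measurable : ∀ t, Measurable (X t)
  cadlag : ∀ ω, IsCadlag (fun t => X t ω)
  indep_increments : HasIndepIncrements X P
  stationary_increments : ∀ s t h : ℝ, s ≤ t →
    P.map (fun ω => X (t + h) ω - X (s + h) ω) = P.map (fun ω => X t ω - X s ω)
  zero : ∀ᵐ ω ∂P, X 0 ω = 0

/-- The expectation `E[Y⁺] - E[Y⁻]`, an element of `[-∞, +∞)` as soon as `E[Y⁺] < ∞`. -/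
def extendedExpectation {Ω : Type*} [MeasurableSpace Ω] (Y : Ω → ℝ) (P : Measure Ω) : EReal :=
  ((∫⁻ ω, ENNReal.ofReal (Y ω) ∂P : ENNReal) : EReal)
    - ((∫⁻ ω, ENNReal.ofReal (-Y ω) ∂P : ENNReal) : EReal)

/-! ### The one-sided minorant and its contact set -/

/-- `L_t = inf {f s + α (t - s) : s ≤ t}`, as an element of `[-∞, +∞)`. -/
def oneSidedMinorant (α : ℝ) (f : ℝ → ℝ) (t : ℝ) : EReal :=
  ⨅ (s : ℝ) (_ : s ≤ t), ((f s + α * (t - s) : ℝ) : EReal)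

/-- `H_α = {t : f(t) ∧ f(t-) = L_t}`. -/
def contactSet (α : ℝ) (f : ℝ → ℝ) : Set ℝ :=
  {t | ((min (f t) (Function.leftLim f t) : ℝ) : EReal) = oneSidedMinorant α f t}

theorem IsCadlag.tendsto_leftLim {f : ℝ → ℝ} (hf : IsCadlag f) (t : ℝ) :
    Tendsto f (𝓝[<] t) (𝓝 (Function.leftLim f t)) :=
  tendsto_leftLim_of_tendsto (hf t).2

theorem oneSidedMinorant_le_min {α : ℝ} {f : ℝ → ℝ} (hf : IsCadlag f) (t : ℝ) :
    oneSidedMinorant α f t ≤ ((min (f t) (Function.leftLim f t) : ℝ) : EReal) := by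
  have h1 : oneSidedMinorant α f t ≤ ((f t : ℝ) : EReal) := by
    have h0 : oneSidedMinorant α f t ≤ ((f t + α * (t - t) : ℝ) : EReal) :=
      iInf₂_le (f := fun (s : ℝ) (_ : s ≤ t) => ((f s + α * (t - s) : ℝ) : EReal)) t le_rfl
    simpa using h0
  have h2 : oneSidedMinorant α f t ≤ ((Function.leftLim f t : ℝ) : EReal) := by
    have hlim : Tendsto (fun s => f s + α * (t - s)) (𝓝[<] t) (𝓝 (Function.leftLim f t)) := by
      have h0 : Tendsto (fun s : ℝ => α * (t - s)) (𝓝[<] t) (𝓝 0) := by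
        have hc : Continuous (fun s : ℝ => α * (t - s)) := by fun_prop
        have := hc.tendsto t
        simp only [sub_self, mul_zero] at this
        exact this.mono_left nhdsWithin_le_nhds
      simpa using (hf.tendsto_leftLim t).add h0
    have hlim' := (continuous_coe_real_ereal.tendsto (Function.leftLim f t)).comp hlim
    refine ge_of_tendsto hlim' ?_
    filter_upwards [self_mem_nhdsWithin] with s hs
    exact iInf₂_le (f := fun (s : ℝ) (_ : s ≤ t) => ((f s + α * (t - s) : ℝ) : EReal)) s
      (le_of_lt (Set.mem_Iio.1 hs))
  rcases min_choice (f t) (Function.leftLim f t) with h | h <;> rw [h] <;> assumption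

theorem mem_contactSet_iff {α : ℝ} {f : ℝ → ℝ} (hf : IsCadlag f) (t : ℝ) :
    t ∈ contactSet α f ↔ ∀ u ≤ t, min (f t) (Function.leftLim f t) ≤ f u + α * (t - u) := by
  have key : t ∈ contactSet α f ↔
      ((min (f t) (Function.leftLim f t) : ℝ) : EReal) ≤ oneSidedMinorant α f t :=
    ⟨fun h => le_of_eq h, fun h => le_antisymm h (oneSidedMinorant_le_min hf t)⟩
  rw [key, oneSidedMinorant, le_iInf₂_iff]
  exact forall₂_congr fun u _ => EReal.coe_le_coe_iff

theorem isClosed_contactSet (α : ℝ) {f : ℝ → ℝ} (hf : IsCadlag f) :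
    IsClosed (contactSet α f) := by
  rw [← isOpen_compl_iff, isOpen_iff_mem_nhds]
  intro t ht
  rw [Set.mem_compl_iff, mem_contactSet_iff hf] at ht
  push Not at ht
  obtain ⟨u, hut, hu⟩ := ht
  have hne : u ≠ t := by
    rintro rfl
    simp at hu
  have hlt : u < t := lt_of_le_of_ne hut hne
  obtain ⟨c, hc1, hc2⟩ := exists_between hu
  have hc : ∀ᶠ s in 𝓝 t, c < f s := by
    rw [← nhdsLT_sup_nhdsGE, eventually_sup]
    exact ⟨(hf.tendsto_leftLim t).eventually (lt_mem_nhds (lt_of_lt_of_le hc2 (min_le_right _ _))),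
      (hf t).1.eventually (lt_mem_nhds (lt_of_lt_of_le hc2 (min_le_left _ _)))⟩
  have hline : ∀ᶠ s in 𝓝 t, f u + α * (s - u) < c := by
    have hcont : Continuous (fun s : ℝ => f u + α * (s - u)) := by fun_prop
    exact (hcont.tendsto t).eventually (gt_mem_nhds hc1)
  filter_upwards [hc.eventually_nhds, hline, lt_mem_nhds hlt] with s h1 h2 h3
  rw [Set.mem_compl_iff, mem_contactSet_iff hf]
  intro h
  have h4 : c ≤ Function.leftLim f s :=
    ge_of_tendsto (hf.tendsto_leftLim s)
      ((h1.filter_mono nhdsWithin_le_nhds).mono fun r hr => le_of_lt hr)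
  have h5 : c ≤ f s := le_of_lt h1.self_of_nhds
  exact absurd (lt_of_le_of_lt ((le_min h5 h4).trans (h u h3.le)) h2) (lt_irrefl c)

/-- The contact set of a càdlàg path, as a point of the space of closed subsets of `ℝ`. -/
def contactCloseds (α : ℝ) (f : ℝ → ℝ) (hf : IsCadlag f) : Closeds ℝ :=
  ⟨contactSet α f, isClosed_contactSet α hf⟩

/-! ### The measurable space of closed subsets of the line -/

/-- `d_t(w) = inf {s > t : s ∈ w}`, with `inf ∅ = +∞`. -/
def nextPoint (t : ℝ) (w : Closeds ℝ) : EReal :=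
  ⨅ (s : ℝ) (_ : s ∈ w ∧ t < s), (s : EReal)

/-- `r_t(w) = d_t(w) - t`. -/
def residual (t : ℝ) (w : Closeds ℝ) : EReal := nextPoint t w - (t : EReal)

/-- The σ-field generated by all the `r_s`, `s ∈ ℝ`. -/
instance instMeasurableSpaceClosedsReal : MeasurableSpace (Closeds ℝ) :=
  ⨆ s : ℝ, MeasurableSpace.comap (residual s) inferInstance

/-- `G_t`, the σ-field generated by the `r_s` with `s ≤ t`. -/
@[reducible] def sigmaUpTo (t : ℝ) : MeasurableSpace (Closeds ℝ) :=
  ⨆ (s : ℝ) (_ : s ≤ t), MeasurableSpace.comap (residual s) inferInstance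

/-- `G_{t+}`, the intersection of the `G_u` with `u > t`. -/
@[reducible] def sigmaUpToPlus (t : ℝ) : MeasurableSpace (Closeds ℝ) :=
  ⨅ (u : ℝ) (_ : t < u), sigmaUpTo u

/-- The closed subsets of `ℝ₊ = [0, ∞)`. As a subtype it carries the trace of the σ-field of
`Closeds ℝ`, that is, the σ-field generated by the restrictions of the maps `r_s`, `s ∈ ℝ`. -/
abbrev NonnegCloseds : Type := {w : Closeds ℝ // (w : Set ℝ) ⊆ Set.Ici 0}

/-- `τ_t(w) = cl {s - t : s ∈ w ∩ (t, ∞)}`. -/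
def shift (t : ℝ) (w : Closeds ℝ) : NonnegCloseds :=
  ⟨⟨closure ((fun s : ℝ => s - t) '' ((w : Set ℝ) ∩ Set.Ioi t)), isClosed_closure⟩, by
    refine closure_minimal ?_ isClosed_Ici
    rintro _ ⟨s, ⟨-, hs⟩, rfl⟩
    exact sub_nonneg.2 (le_of_lt (Set.mem_Ioi.1 hs))⟩

/-- `τ_{d_t}(w)`, the part of `w` after its first point after `t`, seen from that point.
There is nothing left, hence the empty set, when `d_t(w) = +∞`. -/
def shiftNext (t : ℝ) (w : Closeds ℝ) : NonnegCloseds :=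
  open scoped Classical in
  if nextPoint t w = ⊤ then ⟨⊥, by simp⟩ else shift (nextPoint t w).toReal w

/-- The translate `u + w`. -/
def translate (u : ℝ) (w : Closeds ℝ) : Closeds ℝ :=
  ⟨(fun s : ℝ => s - u) ⁻¹' (w : Set ℝ), w.isClosed.preimage (by fun_prop)⟩

/-! ### Stationary and regenerative laws -/

/-- `Q` is stationary: its image under each translation is `Q` again. -/
def IsStationaryLaw (Q : Measure (Closeds ℝ)) : Prop :=
  ∀ u : ℝ, Q.map (translate u) = Q

/-- `Q` is regenerative with regeneration law `R`: both are probability measures,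
`Q {d_t = +∞} = 0` for every `t`, and `Q[F(τ_{d_t}) | G_{t+}] = R[F]` for every `t` and
every nonnegative measurable `F`. -/
structure IsRegenerativeWith (Q : Measure (Closeds ℝ)) (R : Measure NonnegCloseds) : Prop where
  isProbabilityMeasure : IsProbabilityMeasure Q
  isProbabilityMeasure_regeneration : IsProbabilityMeasure R
  next_finite : ∀ t : ℝ, Q {w | nextPoint t w = ⊤} = 0
  regeneration : ∀ (t : ℝ) (F : Closeds ℝ → ENNReal), Measurable F →
    condLExp (sigmaUpToPlus t) Q (fun w => F (shiftNext t w).1) =ᵐ[Q] fun _ => lintegral R (fun v => F v.1)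

/-- `Q` is a regenerative law. -/
def IsRegenerativeLaw (Q : Measure (Closeds ℝ)) : Prop :=
  ∃ R : Measure NonnegCloseds, IsRegenerativeWith Q R

end RegenerativeSet

end

/-! Subtracting the drift `α t` reduces everything to slope `0`: a contact point is a time at which
`f(t) ∧ f(t-)` lies below the whole past. This function is lower semicontinuous, so it attains its
minimum on compact intervals, and a minimiser over `[a, b]` is a contact point once its value lies
below the path before `a`. Hence contact points can be found from countably many increments, which
gives measurability and makes `d_t` a stopping time (in the sense of the events `{d_t < u}`). The
contact set depends on increments only, so stationarity follows from that of the increments.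

Contact points exist beyond every time because the drifted path tends to `-∞` along the integers and
is bounded below on the past. Both come from the law of large numbers, after truncation since the
mean may be `-∞`; Ottaviani's inequality passes from integer times to all negative times.

Regeneration is the strong Markov property at `D = d_t`. If `X_D ≤ X_{D-}`, then `X_D` is itself a
minimum of the past, and the contact set after `D` is that of the path restarted at `D`
(`IsCadlag.mem_contactSet_postPath_iff`). So upward jumps at `D` must be excluded. If `D` were a
contact point with an upward jump, the contact value would be `X_{D-}`, and the times at which the
path comes within `1 / (k + 1)` of its past infimum would announce `D` strictly from before. A Lévy
process has no upward jump at an announced time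
(`IsTwoSidedLevyProcess.ae_le_leftLim_of_announced`): otherwise the path restarted at the announcing
times would keep oscillating by a fixed amount in arbitrarily short time. -/

namespace RegenerativeSet

/-! ### Càdlàg paths and their contact sets -/

/-- The lower envelope `f(t) ∧ f(t-)` of a path. -/
noncomputable def lowerEnv (f : ℝ → ℝ) (t : ℝ) : ℝ := min (f t) (Function.leftLim f t)

theorem lowerEnv_le (f : ℝ → ℝ) (t : ℝ) : lowerEnv f t ≤ f t := min_le_left _ _

theorem mem_contactSet_zero_iff {f : ℝ → ℝ} (hf : IsCadlag f) (t : ℝ) :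
    t ∈ contactSet 0 f ↔ ∀ u ≤ t, lowerEnv f t ≤ f u := by
  simp [mem_contactSet_iff hf, lowerEnv]

/-- A level below both one-sided values at a point is exceeded by the path on a neighbourhood, and
such a bound passes to left limits. This is why minima are taken of `lowerEnv f`: the path itself
need not attain its infimum. -/
theorem IsCadlag.lowerSemicontinuous_lowerEnv {f : ℝ → ℝ} (hf : IsCadlag f) :
    LowerSemicontinuous (lowerEnv f) := by
  intro t y hy
  change y < lowerEnv f t at hy
  obtain ⟨c, hyc, hc⟩ := exists_between hy
  have h : ∀ᶠ s in 𝓝 t, c < f s := by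
    rw [← nhdsLT_sup_nhdsGE, eventually_sup]
    exact ⟨(hf.tendsto_leftLim t).eventually (lt_mem_nhds (hc.trans_le (min_le_right _ _))),
      (hf t).1.eventually (lt_mem_nhds (hc.trans_le (min_le_left _ _)))⟩
  filter_upwards [h.eventually_nhds] with s hs
  refine hyc.trans_le (le_min hs.self_of_nhds.le ?_)
  exact ge_of_tendsto (hf.tendsto_leftLim s)
    ((hs.filter_mono nhdsWithin_le_nhds).mono fun r hr => le_of_lt hr)

theorem IsCadlag.exists_isMinOn_lowerEnv {f : ℝ → ℝ} (hf : IsCadlag f) {a b : ℝ} (hab : a ≤ b) :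
    ∃ s ∈ Set.Icc a b, ∀ u ∈ Set.Icc a b, lowerEnv f s ≤ lowerEnv f u := by
  obtain ⟨s, hs, h⟩ := (hf.lowerSemicontinuous_lowerEnv.lowerSemicontinuousOn
    (Set.Icc a b)).exists_isMinOn (Set.nonempty_Icc.2 hab) isCompact_Icc
  exact ⟨s, hs, fun u hu => h hu⟩

theorem IsCadlag.exists_rat_lt_of_lt {f : ℝ → ℝ} (hf : IsCadlag f) {t b c : ℝ} (htb : t < b)
    (h : f t < c) : ∃ q : ℚ, t < q ∧ (q : ℝ) < b ∧ f q < c := by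
  have h1 : ∀ᶠ s in 𝓝[>] t, f s < c :=
    ((hf t).1.eventually (gt_mem_nhds h)).filter_mono (nhdsWithin_mono _ Set.Ioi_subset_Ici_self)
  obtain ⟨d, hd, hsub⟩ := mem_nhdsGT_iff_exists_Ioo_subset.1 h1
  obtain ⟨q, hq1, hq2⟩ := exists_rat_btwn (lt_min htb hd)
  exact ⟨q, hq1, hq2.trans_le (min_le_left _ _), hsub ⟨hq1, hq2.trans_le (min_le_right _ _)⟩⟩

theorem IsCadlag.exists_rat_lt_of_leftLim_lt {f : ℝ → ℝ} (hf : IsCadlag f) {t a c : ℝ}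
    (hat : a < t) (h : Function.leftLim f t < c) : ∃ q : ℚ, a < q ∧ (q : ℝ) < t ∧ f q < c := by
  have h1 : ∀ᶠ s in 𝓝[<] t, f s < c := (hf.tendsto_leftLim t).eventually (gt_mem_nhds h)
  obtain ⟨d, hd, hsub⟩ := mem_nhdsLT_iff_exists_Ioo_subset.1 h1
  obtain ⟨q, hq1, hq2⟩ := exists_rat_btwn (max_lt hat hd)
  exact ⟨q, (le_max_left _ _).trans_lt hq1, hq2, hsub ⟨(le_max_right _ _).trans_lt hq1, hq2⟩⟩

theorem IsCadlag.exists_rat_lt_of_lowerEnv_lt {f : ℝ → ℝ} (hf : IsCadlag f) {t a b c : ℝ}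
    (hat : a < t) (htb : t < b) (h : lowerEnv f t < c) :
    ∃ q : ℚ, a < q ∧ (q : ℝ) < b ∧ f q < c := by
  rcases min_lt_iff.1 h with h | h
  · obtain ⟨q, h1, h2, h3⟩ := hf.exists_rat_lt_of_lt htb h
    exact ⟨q, hat.trans h1, h2, h3⟩
  · obtain ⟨q, h1, h2, h3⟩ := hf.exists_rat_lt_of_leftLim_lt hat h
    exact ⟨q, h1, h2.trans htb, h3⟩

/-- The minimum over `[a, b]` is a contact point as soon as it lies below the path before `a`. -/
theorem IsCadlag.mem_contactSet_of_isMinOn {f : ℝ → ℝ} (hf : IsCadlag f) {a b s : ℝ}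
    (hs : s ∈ Set.Icc a b) (hmin : ∀ u ∈ Set.Icc a b, lowerEnv f s ≤ lowerEnv f u)
    (hrat : ∀ q : ℚ, (q : ℝ) < a → lowerEnv f s ≤ f q) : s ∈ contactSet 0 f := by
  rw [mem_contactSet_zero_iff hf]
  intro u hus
  rcases lt_or_ge u a with hua | hua
  · by_contra! hlt
    obtain ⟨q, -, hqa, hq⟩ := hf.exists_rat_lt_of_lt hua hlt
    exact absurd (hrat q hqa) (not_le.2 hq)
  · exact (hmin u ⟨hua, hus.trans hs.2⟩).trans (lowerEnv_le f u)

/-- The path takes values arbitrarily close to `lowerEnv f s` at rationals near `s`; conversely, the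
rational condition puts the minimum of `lowerEnv f` over `[a, b]` below the path before `a`. The
slack `1 / (n + 1)` is needed because the contact value may only be approached. Only differences of
`f` at rational times before `u` occur, so the event is known by time `u`. -/
theorem IsCadlag.exists_mem_contactSet_iff {f : ℝ → ℝ} (hf : IsCadlag f) (t u : ℝ) :
    (∃ s ∈ contactSet 0 f, t < s ∧ s < u) ↔
      ∃ a b : ℚ, (t < a ∧ (b : ℝ) < u ∧ a < b) ∧ ∀ p : ℚ, p ≤ a → ∀ n : ℕ,
        ∃ q : ℚ, (a < q ∧ q < b) ∧ f q - f p < 1 / ((n : ℝ) + 1) := by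
  constructor
  · rintro ⟨s, hs, hts, hsu⟩
    rw [mem_contactSet_zero_iff hf] at hs
    obtain ⟨a, hta, has⟩ := exists_rat_btwn hts
    obtain ⟨b, hsb, hbu⟩ := exists_rat_btwn hsu
    refine ⟨a, b, ⟨hta, hbu, by exact_mod_cast has.trans hsb⟩, fun p hp n => ?_⟩
    have hps : (p : ℝ) ≤ s := le_trans (by exact_mod_cast hp) has.le
    have hlt : lowerEnv f s < f p + 1 / ((n : ℝ) + 1) :=
      (hs p hps).trans_lt (lt_add_of_pos_right _ (by positivity))
    obtain ⟨q, h1, h2, h3⟩ := hf.exists_rat_lt_of_lowerEnv_lt has hsb hlt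
    exact ⟨q, ⟨by exact_mod_cast h1, by exact_mod_cast h2⟩, by linarith⟩
  · rintro ⟨a, b, ⟨hta, hbu, hab⟩, h⟩
    have hab' : (a : ℝ) ≤ b := by exact_mod_cast hab.le
    obtain ⟨s, hs, hmin⟩ := hf.exists_isMinOn_lowerEnv hab'
    refine ⟨s, hf.mem_contactSet_of_isMinOn hs hmin fun p hp => ?_, hta.trans_le hs.1,
      hs.2.trans_lt hbu⟩
    refine le_of_forall_pos_lt_add fun ε hε => ?_
    obtain ⟨n, hn⟩ := exists_nat_one_div_lt hε
    obtain ⟨q, ⟨h1, h2⟩, h3⟩ := h p (by exact_mod_cast hp.le) n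
    have h4 := (hmin q ⟨by exact_mod_cast h1.le, by exact_mod_cast h2.le⟩).trans (lowerEnv_le f q)
    linarith

theorem IsCadlag.exists_forall_le {f : ℝ → ℝ} (hf : IsCadlag f) (a b : ℝ) :
    ∃ c, ∀ s ∈ Set.Icc a b, c ≤ f s := by
  rcases le_or_gt a b with hab | hab
  · obtain ⟨s, -, h⟩ := hf.exists_isMinOn_lowerEnv hab
    exact ⟨lowerEnv f s, fun u hu => (h u hu).trans (lowerEnv_le f u)⟩
  · exact ⟨0, fun s hs => absurd (hs.1.trans hs.2) (not_le.2 hab)⟩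

/-- Minimise over `[t + 1, n]`, with `n` so large that `f n` lies below the whole path before `t +
1`. -/
theorem IsCadlag.exists_mem_contactSet_gt {f : ℝ → ℝ} (hf : IsCadlag f)
    (hbot : Tendsto (fun n : ℕ => f n) atTop atBot) (hbdd : ∃ c, ∀ s ≤ 0, c ≤ f s) (t : ℝ) :
    ∃ s ∈ contactSet 0 f, t < s := by
  obtain ⟨c₁, h₁⟩ := hbdd
  obtain ⟨c₂, h₂⟩ := hf.exists_forall_le 0 (t + 1)
  obtain ⟨n, hn1, hn2⟩ := ((hbot.eventually_lt_atBot (min c₁ c₂)).and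
    (tendsto_natCast_atTop_atTop (R := ℝ) |>.eventually_ge_atTop (t + 1))).exists
  obtain ⟨s, hs, hmin⟩ := hf.exists_isMinOn_lowerEnv hn2
  refine ⟨s, hf.mem_contactSet_of_isMinOn hs hmin fun q hq => ?_, by linarith [hs.1]⟩
  have h3 : lowerEnv f s ≤ min c₁ c₂ :=
    ((hmin n ⟨hn2, le_rfl⟩).trans (lowerEnv_le f n)).trans hn1.le
  rcases le_or_gt (q : ℝ) 0 with hq0 | hq0
  · exact (h3.trans (min_le_left _ _)).trans (h₁ q hq0)
  · exact (h3.trans (min_le_right _ _)).trans (h₂ q ⟨hq0.le, hq.le⟩)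

theorem IsCadlag.leftLim_eq {f : ℝ → ℝ} {t l : ℝ} (h : Tendsto f (𝓝[<] t) (𝓝 l)) :
    Function.leftLim f t = l :=
  tendsto_nhds_unique (tendsto_leftLim_of_tendsto ⟨l, h⟩) h

theorem IsCadlag.add_continuous {f g : ℝ → ℝ} (hf : IsCadlag f) (hg : Continuous g) :
    IsCadlag (fun t => f t + g t) := fun t =>
  ⟨(hf t).1.add hg.continuousWithinAt,
    _, (hf.tendsto_leftLim t).add (hg.continuousWithinAt (s := Set.Iio t)).tendsto⟩

theorem IsCadlag.leftLim_add_continuous {f g : ℝ → ℝ} (hf : IsCadlag f) (hg : Continuous g)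
    (t : ℝ) : Function.leftLim (fun s => f s + g s) t = Function.leftLim f t + g t :=
  leftLim_eq ((hf.tendsto_leftLim t).add (hg.continuousWithinAt (s := Set.Iio t)).tendsto)

theorem contactSet_eq_contactSet_zero {f : ℝ → ℝ} (hf : IsCadlag f) (α : ℝ) :
    contactSet α f = contactSet 0 (fun t => f t + -α * t) := by
  have hg : Continuous (fun t : ℝ => -α * t) := by fun_prop
  ext t
  rw [mem_contactSet_iff hf, mem_contactSet_iff (hf.add_continuous hg),
    hf.leftLim_add_continuous hg, min_add_add_right]
  refine forall₂_congr fun u _ => ?_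
  constructor <;> intro h <;> linarith

/-- The path `f` seen from the point `(x, f x)`, restricted to times after `x`, and continued by a
constant before `x`. -/
def postPath (x : ℝ) (f : ℝ → ℝ) (s : ℝ) : ℝ := f (x + max s 0) - f x

theorem tendsto_const_add_nhdsLT {f : ℝ → ℝ} (hf : IsCadlag f) (x s : ℝ) :
    Tendsto (fun r => f (x + r)) (𝓝[<] s) (𝓝 (Function.leftLim f (x + s))) := by
  refine (hf.tendsto_leftLim (x + s)).comp (tendsto_nhdsWithin_iff.2 ⟨?_, ?_⟩)
  · exact ((continuous_const_add x).tendsto s).mono_left nhdsWithin_le_nhds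
  · filter_upwards [self_mem_nhdsWithin] with r hr
    exact add_lt_add_right (Set.mem_Iio.1 hr) x

theorem tendsto_const_add_nhdsGE {f : ℝ → ℝ} (hf : IsCadlag f) (x s : ℝ) :
    Tendsto (fun r => f (x + r)) (𝓝[≥] s) (𝓝 (f (x + s))) := by
  refine Tendsto.comp (hf (x + s)).1 (tendsto_nhdsWithin_iff.2 ⟨?_, ?_⟩)
  · exact ((continuous_const_add x).tendsto s).mono_left nhdsWithin_le_nhds
  · filter_upwards [self_mem_nhdsWithin] with r hr
    exact add_le_add_right (Set.mem_Ici.1 hr) x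

theorem IsCadlag.comp_const_add {f : ℝ → ℝ} (hf : IsCadlag f) (x : ℝ) :
    IsCadlag (fun s => f (x + s)) := fun s =>
  ⟨tendsto_const_add_nhdsGE hf x s, _, tendsto_const_add_nhdsLT hf x s⟩

theorem IsCadlag.postPath_tendsto_nhdsLT {f : ℝ → ℝ} (hf : IsCadlag f) (x : ℝ) {s : ℝ}
    (hs : 0 < s) :
    Tendsto (postPath x f) (𝓝[<] s) (𝓝 (Function.leftLim f (x + s) - f x)) := by
  refine ((tendsto_const_add_nhdsLT hf x s).sub_const (f x)).congr' ?_
  filter_upwards [mem_nhdsWithin_of_mem_nhds (lt_mem_nhds hs)] with r hr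
  rw [postPath, max_eq_left (le_of_lt hr)]

theorem isCadlag_postPath {f : ℝ → ℝ} (hf : IsCadlag f) (x : ℝ) : IsCadlag (postPath x f) := by
  intro s
  refine ⟨?_, ?_⟩
  · have h1 : Tendsto (fun r : ℝ => max r 0) (𝓝[≥] s) (𝓝[≥] (max s 0)) := by
      refine tendsto_nhdsWithin_iff.2 ⟨?_, ?_⟩
      · exact ((by fun_prop : Continuous fun r : ℝ => max r 0).tendsto s).mono_left
          nhdsWithin_le_nhds
      · filter_upwards [self_mem_nhdsWithin] with r hr
        exact max_le_max (Set.mem_Ici.1 hr) le_rfl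
    exact ((tendsto_const_add_nhdsGE hf x (max s 0)).comp h1).sub_const _
  · rcases lt_or_ge 0 s with hs | hs
    · exact ⟨_, hf.postPath_tendsto_nhdsLT x hs⟩
    · refine ⟨0, tendsto_const_nhds.congr' ?_⟩
      filter_upwards [self_mem_nhdsWithin] with r hr
      rw [postPath, max_eq_right ((Set.mem_Iio.1 hr).le.trans hs), add_zero, sub_self]

theorem lowerEnv_postPath {f : ℝ → ℝ} (hf : IsCadlag f) (x : ℝ) {s : ℝ} (hs : 0 < s) :
    lowerEnv (postPath x f) s = lowerEnv f (x + s) - f x := by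
  rw [lowerEnv, IsCadlag.leftLim_eq (hf.postPath_tendsto_nhdsLT x hs), postPath,
    max_eq_left hs.le, min_sub_sub_right, lowerEnv]

/-- After a contact point without upward jump, the contact set is that of the post-path. -/
theorem IsCadlag.mem_contactSet_postPath_iff {f : ℝ → ℝ} (hf : IsCadlag f) {x : ℝ}
    (hx : x ∈ contactSet 0 f) (hjump : f x ≤ Function.leftLim f x) {s : ℝ} (hs : 0 < s) :
    s ∈ contactSet 0 (postPath x f) ↔ x + s ∈ contactSet 0 f := by
  rw [mem_contactSet_zero_iff (isCadlag_postPath hf x), mem_contactSet_zero_iff hf,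
    lowerEnv_postPath hf x hs]
  rw [mem_contactSet_zero_iff hf, lowerEnv, min_eq_left hjump] at hx
  constructor
  · intro h u hu
    rcases le_or_gt u x with hux | hux
    -- The post-path vanishes at time `0`, so this comparison puts the new value below `f x`, which
    -- already lies below everything before `x`.
    · have h0 := h 0 hs.le
      rw [postPath, max_self, add_zero, sub_self] at h0
      linarith [hx u hux]
    · have h0 := h (u - x) (by linarith)
      rw [postPath, max_eq_left (by linarith), add_sub_cancel] at h0
      linarith
  · intro h u hu
    have := h (x + max u 0) (by simpa using ⟨hu, hs.le⟩)
    rw [postPath]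
    linarith

/-- The contact set is a function of the increments alone and moves with the time origin; this is
the source of stationarity. -/
theorem contactSet_comp_const_add {f : ℝ → ℝ} (hf : IsCadlag f) (x t : ℝ) :
    t ∈ contactSet 0 (fun s => f (x + s) - f x) ↔ x + t ∈ contactSet 0 f := by
  have hc : IsCadlag (fun s => f (x + s) - f x) := by
    simpa [sub_eq_add_neg] using
      (hf.comp_const_add x).add_continuous (continuous_const (y := -f x))
  have hl : Function.leftLim (fun s => f (x + s) - f x) t = Function.leftLim f (x + t) - f x :=
    IsCadlag.leftLim_eq ((tendsto_const_add_nhdsLT hf x t).sub_const _)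
  rw [mem_contactSet_zero_iff hc, mem_contactSet_zero_iff hf, lowerEnv, lowerEnv, hl,
    min_sub_sub_right]
  constructor
  · intro h u hu
    have := h (u - x) (by linarith)
    rw [add_sub_cancel] at this
    linarith
  · intro h u hu
    linarith [h (x + u) (by linarith)]

/-! ### Measurability on the space of closed sets -/

theorem nextPoint_lt_iff {t : ℝ} {w : Closeds ℝ} {x : EReal} :
    nextPoint t w < x ↔ ∃ s ∈ w, t < s ∧ (s : EReal) < x := by
  simp only [nextPoint, iInf_lt_iff, exists_prop, and_assoc]

theorem nextPoint_lt_coe_iff {t u : ℝ} {w : Closeds ℝ} :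
    nextPoint t w < (u : EReal) ↔ ∃ s ∈ w, t < s ∧ s < u := by
  simp only [nextPoint_lt_iff, EReal.coe_lt_coe_iff]

theorem le_nextPoint (t : ℝ) (w : Closeds ℝ) : (t : EReal) ≤ nextPoint t w :=
  le_iInf₂ fun _ hs => EReal.coe_le_coe_iff.2 hs.2.le

theorem nextPoint_mono (w : Closeds ℝ) : Monotone fun t => nextPoint t w := fun _ _ hst =>
  le_iInf₂ fun s hs => iInf₂_le s ⟨hs.1, hst.trans_lt hs.2⟩

theorem nextPoint_le {t s : ℝ} {w : Closeds ℝ} (hs : s ∈ w) (hts : t < s) :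
    nextPoint t w ≤ s :=
  iInf₂_le s ⟨hs, hts⟩

theorem exists_nextPoint_eq_coe {t : ℝ} {w : Closeds ℝ} (h : nextPoint t w ≠ ⊤) :
    ∃ D : ℝ, nextPoint t w = D := by
  have hb : nextPoint t w ≠ ⊥ := fun hb => by
    have := le_nextPoint t w
    rw [hb] at this
    exact absurd this (not_le.2 (EReal.bot_lt_coe t))
  exact ⟨_, (EReal.coe_toReal h hb).symm⟩

theorem mem_of_nextPoint_eq {t D : ℝ} {w : Closeds ℝ} (h : nextPoint t w = D) : D ∈ w := by
  refine (w.isClosed.closure_eq ▸ Metric.mem_closure_iff.2 fun ε hε => ?_ : D ∈ (w : Set ℝ))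
  obtain ⟨s, hs, hts, hsu⟩ := nextPoint_lt_coe_iff.1
    (h.trans_lt (EReal.coe_lt_coe_iff.2 (lt_add_of_pos_right D hε)))
  have := nextPoint_le hs hts
  rw [h, EReal.coe_le_coe_iff] at this
  refine ⟨s, hs, ?_⟩
  rw [Real.dist_eq, abs_sub_comm, abs_of_nonneg (by linarith)]
  linarith

theorem nextPoint_eq_of_lt {t r D : ℝ} {w : Closeds ℝ} (h : nextPoint t w = D) (htr : t ≤ r)
    (hr : r < D) : nextPoint r w = D := by
  refine le_antisymm (nextPoint_le (mem_of_nextPoint_eq h) hr) ?_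
  exact h ▸ nextPoint_mono w htr

/-- Right-continuity of `t ↦ d_t`, in the form that lets `G_{t+}` be handled through the `G_q` with
rational `q > t`. -/
theorem nextPoint_lt_iff_exists_rat {t : ℝ} {w : Closeds ℝ} {x : EReal} :
    nextPoint t w < x ↔ ∃ q : ℚ, t < q ∧ nextPoint q w < x := by
  constructor
  · intro h
    obtain ⟨s, hs, hts, hsx⟩ := nextPoint_lt_iff.1 h
    obtain ⟨q, htq, hqs⟩ := exists_rat_btwn hts
    exact ⟨q, htq, nextPoint_lt_iff.2 ⟨s, hs, hqs, hsx⟩⟩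
  · rintro ⟨q, htq, h⟩
    exact (nextPoint_mono w htq.le).trans_lt h

theorem measurable_ereal_of_lt_coe {Ω : Type*} [MeasurableSpace Ω] {g : Ω → EReal}
    (hg : ∀ u : ℝ, MeasurableSet {ω | g ω < u}) : Measurable g := by
  refine measurable_of_Iio fun x => ?_
  have : g ⁻¹' Set.Iio x =
      ⋃ (q : ℚ) (_ : ((q : ℝ) : EReal) ≤ x), {ω | g ω < ((q : ℝ) : EReal)} := by
    ext ω
    simp only [Set.mem_preimage, Set.mem_Iio, Set.mem_iUnion, Set.mem_ofPred_eq, exists_prop]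
    constructor
    · intro h
      obtain ⟨q, h1, h2⟩ := EReal.exists_rat_btwn_of_lt h
      exact ⟨q, h2.le, h1⟩
    · rintro ⟨q, h1, h2⟩
      exact h2.trans_le h1
  rw [this]
  exact MeasurableSet.iUnion fun q => MeasurableSet.iUnion fun _ => hg q

theorem residual_lt_coe_iff {t u : ℝ} {w : Closeds ℝ} :
    residual t w < u ↔ nextPoint t w < ((u + t : ℝ) : EReal) := by
  unfold residual
  by_cases h : nextPoint t w = ⊤
  · simp [h]
  · obtain ⟨D, hD⟩ := exists_nextPoint_eq_coe h
    rw [hD, ← EReal.coe_sub, EReal.coe_lt_coe_iff, EReal.coe_lt_coe_iff, sub_lt_iff_lt_add]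

theorem measurable_closeds_of_nextPoint_lt {Ω : Type*} [MeasurableSpace Ω] {g : Ω → Closeds ℝ}
    (hg : ∀ t u : ℝ, MeasurableSet {ω | nextPoint t (g ω) < u}) : Measurable g := by
  refine measurable_iff_le_map.2 (iSup_le fun t => ?_)
  rw [MeasurableSpace.comap_le_iff_le_map, MeasurableSpace.map_comp, ← measurable_iff_le_map]
  refine measurable_ereal_of_lt_coe fun u => ?_
  simp only [Function.comp_apply, residual_lt_coe_iff]
  exact hg _ _

theorem measurable_nextPoint (t : ℝ) : Measurable (nextPoint t) := by
  refine measurable_ereal_of_lt_coe fun u => ?_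
  have h : Measurable (residual t) :=
    Measurable.mono (comap_measurable (residual t)) (le_iSup
      (fun s : ℝ => MeasurableSpace.comap (residual s) inferInstance) t) le_rfl
  have : {w | nextPoint t w < u} = residual t ⁻¹' Set.Iio ((u - t : ℝ) : EReal) := by
    ext w
    rw [Set.mem_preimage, Set.mem_Iio, residual_lt_coe_iff, sub_add_cancel]
    rfl
  rw [this]
  exact h measurableSet_Iio

theorem measurable_translate (u : ℝ) : Measurable (translate u) := by
  refine measurable_closeds_of_nextPoint_lt fun t x => ?_
  have : {w | nextPoint t (translate u w) < x} =
      {w | nextPoint (t - u) w < ((x - u : ℝ) : EReal)} := by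
    ext w
    simp only [Set.mem_ofPred_eq, nextPoint_lt_coe_iff]
    constructor
    · rintro ⟨s, hs, h1, h2⟩
      exact ⟨s - u, hs, by linarith, by linarith⟩
    · rintro ⟨s, hs, h1, h2⟩
      refine ⟨s + u, ?_, by linarith, by linarith⟩
      change s + u - u ∈ w
      rwa [add_sub_cancel_right]
  rw [this]
  exact measurable_nextPoint _ measurableSet_Iio

theorem nextPoint_shift_lt_coe_iff {s t u : ℝ} {w : Closeds ℝ} :
    nextPoint s (shift t w).1 < (u : EReal) ↔ ∃ v ∈ w, t + max s 0 < v ∧ v < t + u := by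
  rw [nextPoint_lt_coe_iff]
  constructor
  · rintro ⟨y, hy, hsy, hyu⟩
    obtain ⟨_, ⟨hz1, hz2⟩, v, ⟨hv, htv⟩, rfl⟩ := mem_closure_iff.1
      (show y ∈ closure ((fun s : ℝ => s - t) '' ((w : Set ℝ) ∩ Set.Ioi t)) from hy)
      (Set.Ioo s u) isOpen_Ioo ⟨hsy, hyu⟩
    rw [Set.mem_Ioi] at htv
    refine ⟨v, hv, ?_, by linarith⟩
    rcases max_choice s 0 with h | h <;> rw [h] <;> linarith
  · rintro ⟨v, hv, h1, h2⟩
    refine ⟨v - t, subset_closure ⟨v, ⟨hv, ?_⟩, rfl⟩, ?_, by linarith⟩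
    · rw [Set.mem_Ioi]; linarith [le_max_right s 0]
    · linarith [le_max_left s 0]

/-- Writing `D` for a finite `d_t`, rationals are inserted on both sides of a point `v` of `w`: `D +
max s 0 < r < v < q < D + u`. The random shift is thereby replaced by countably many conditions on
`d_t` and `d_r`. -/
theorem nextPoint_shiftNext_lt_coe_iff {s t u : ℝ} {w : Closeds ℝ} :
    nextPoint s (shiftNext t w).1 < (u : EReal) ↔
      ∃ r q : ℚ, nextPoint t w < ((r - max s 0 : ℝ) : EReal) ∧
        nextPoint r w < ((q : ℝ) : EReal) ∧ ((q - u : ℝ) : EReal) ≤ nextPoint t w := by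
  by_cases h : nextPoint t w = ⊤
  · rw [shiftNext, if_pos h, nextPoint_lt_coe_iff]
    simp only [h, not_top_lt, false_and, exists_false, iff_false]
    rintro ⟨v, hv, -⟩
    exact hv
  · obtain ⟨D, hD⟩ := exists_nextPoint_eq_coe h
    rw [shiftNext, if_neg h, nextPoint_shift_lt_coe_iff, hD, EReal.toReal_coe]
    simp only [EReal.coe_lt_coe_iff, EReal.coe_le_coe_iff, nextPoint_lt_coe_iff]
    constructor
    · rintro ⟨v, hv, h1, h2⟩
      obtain ⟨r, hr1, hr2⟩ := exists_rat_btwn h1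
      obtain ⟨q, hq1, hq2⟩ := exists_rat_btwn h2
      exact ⟨r, q, by linarith, ⟨v, hv, hr2, hq1⟩, by linarith⟩
    · rintro ⟨r, q, h1, ⟨v, hv, h2, h3⟩, h4⟩
      exact ⟨v, hv, by linarith, by linarith⟩

theorem measurable_shiftNext (t : ℝ) : Measurable (shiftNext t) := by
  refine Measurable.subtype_mk (f := fun w => (shiftNext t w).1) ?_
  refine measurable_closeds_of_nextPoint_lt fun s u => ?_
  simp only [nextPoint_shiftNext_lt_coe_iff, Set.ofPred_exists]
  refine MeasurableSet.iUnion fun r => MeasurableSet.iUnion fun q => ?_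
  exact (measurable_nextPoint t measurableSet_Iio).inter
    ((measurable_nextPoint r measurableSet_Iio).inter (measurable_nextPoint t measurableSet_Ici))

theorem sigmaUpTo_le (t : ℝ) : sigmaUpTo t ≤ instMeasurableSpaceClosedsReal :=
  iSup₂_le fun s _ => le_iSup (fun s : ℝ => MeasurableSpace.comap (residual s) inferInstance) s

theorem sigmaUpToPlus_le (t : ℝ) : sigmaUpToPlus t ≤ instMeasurableSpaceClosedsReal :=
  (iInf₂_le (t + 1) (lt_add_one t)).trans (sigmaUpTo_le _)

/-! ### The next point as a stopping time -/

/-- Before `d_v < u`, the sets of `G_v` are decided by time `u`. -/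
theorem measurableSet_preimage_inter_of_sigmaUpTo {Ω : Type*} {m : MeasurableSpace Ω}
    {H : Ω → Closeds ℝ} {u : ℝ}
    (hH : ∀ s x : ℝ, x ≤ u → MeasurableSet[m] {ω | nextPoint s (H ω) < x})
    {v : ℝ} {A : Set (Closeds ℝ)} (hA : MeasurableSet[sigmaUpTo v] A) :
    MeasurableSet[m] (H ⁻¹' A ∩ {ω | nextPoint v (H ω) < u}) := by
  -- On the trace of `{d_v < u}` one has `d_s ≤ d_v < u` for `s ≤ v`, so the threshold `x + s` of a
  -- generator can be lowered to `min (x + s) u` without changing the event.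
  have hsub : MeasurableSet[m.comap (Subtype.val : {ω // nextPoint v (H ω) < u} → Ω)]
      ((fun ω : {ω // nextPoint v (H ω) < u} => H ω.1) ⁻¹' A) := by
    refine measurable_iff_le_map.2 (iSup₂_le fun s hs => ?_) hA
    rw [MeasurableSpace.comap_le_iff_le_map, MeasurableSpace.map_comp, ← measurable_iff_le_map]
    refine measurable_ereal_of_lt_coe fun x => ?_
    refine ⟨{ω | nextPoint s (H ω) < ((min (x + s) u : ℝ) : EReal)}, hH _ _ (min_le_right _ _), ?_⟩
    ext ω
    have h1 : nextPoint s (H ω.1) < u := (nextPoint_mono (H ω.1) hs).trans_lt ω.2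
    simp only [Set.mem_preimage, Set.mem_ofPred_eq, Function.comp_apply, residual_lt_coe_iff,
      nextPoint_lt_coe_iff (u := min (x + s) u), nextPoint_lt_coe_iff (u := x + s)]
    constructor
    · rintro ⟨r, hr, h2, h3⟩
      exact ⟨r, hr, h2, h3.trans_le (min_le_left _ _)⟩
    · rintro ⟨r, hr, h2, h3⟩
      obtain ⟨r', hr', h2', h3'⟩ := nextPoint_lt_coe_iff.1 h1
      exact ⟨min r r', by rcases min_choice r r' with h | h <;> rw [h] <;> assumption,
        lt_min h2 h2', lt_min ((min_le_left _ _).trans_lt h3) ((min_le_right _ _).trans_lt h3')⟩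
  obtain ⟨B, hB, hBA⟩ := hsub
  have : H ⁻¹' A ∩ {ω | nextPoint v (H ω) < u} = B ∩ {ω | nextPoint v (H ω) < u} := by
    ext ω
    refine and_congr_left fun hω => ?_
    exact (Set.ext_iff.1 hBA ⟨ω, hω⟩).symm
  rw [this]
  exact hB.inter (hH v u le_rfl)

theorem measurableSet_preimage_inter_of_sigmaUpToPlus {Ω : Type*} {m : MeasurableSpace Ω}
    {H : Ω → Closeds ℝ} {u : ℝ}
    (hH : ∀ s x : ℝ, x ≤ u → MeasurableSet[m] {ω | nextPoint s (H ω) < x})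
    {t : ℝ} {A : Set (Closeds ℝ)} (hA : MeasurableSet[sigmaUpToPlus t] A) :
    MeasurableSet[m] (H ⁻¹' A ∩ {ω | nextPoint t (H ω) < u}) := by
  have : H ⁻¹' A ∩ {ω | nextPoint t (H ω) < u} =
      ⋃ (q : ℚ) (_ : t < q), H ⁻¹' A ∩ {ω | nextPoint q (H ω) < u} := by
    ext ω
    simp only [Set.mem_inter_iff, Set.mem_ofPred_eq, Set.mem_iUnion, exists_prop,
      nextPoint_lt_iff_exists_rat (t := t)]
    tauto
  rw [this]
  refine MeasurableSet.iUnion fun q => MeasurableSet.iUnion fun hq => ?_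
  exact measurableSet_preimage_inter_of_sigmaUpTo hH
    (iInf₂_le (f := fun u (_ : t < u) => sigmaUpTo u) (q : ℝ) hq A hA)

section

/-! ### Increments of Lévy processes -/

/-- The increasing enumeration, made constant after the last element. It feeds finite sets of times
into `HasIndepIncrements.nat`; the repeated times only add zero increments. -/
theorem exists_monotone_seq_covering {S : Finset ℝ} (hS : S.Nonempty) :
    ∃ τ : ℕ → ℝ, Monotone τ ∧ ∀ s ∈ S, ∃ i, τ i = s := by
  have hpos : 0 < S.card := hS.card_pos
  refine ⟨fun k => S.orderEmbOfFin rfl ⟨min k (S.card - 1), by omega⟩, fun a b hab => ?_,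
    fun s hs => ?_⟩
  · refine (S.orderEmbOfFin rfl).monotone ?_
    rw [Fin.mk_le_mk]
    omega
  · obtain ⟨i, rfl⟩ : s ∈ Set.range (S.orderEmbOfFin rfl) := by
      rw [Finset.range_orderEmbOfFin]; exact hs
    refine ⟨i, ?_⟩
    exact congrArg _ (Fin.ext (by simp only; omega))

/-- The σ-field of the increments before time `u`. -/
@[reducible] def pastSigma {Ω : Type*} (X : ℝ → Ω → ℝ) (u : ℝ) : MeasurableSpace Ω :=
  MeasurableSpace.comap (fun ω s => X (min s u) ω - X u ω) MeasurableSpace.pi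

theorem measurable_sub_pastSigma {Ω : Type*} (X : ℝ → Ω → ℝ) {r s u : ℝ} (hr : r ≤ u)
    (hs : s ≤ u) : Measurable[pastSigma X u] (fun ω => X r ω - X s ω) := by
  let _ := pastSigma X u
  have h : Measurable (fun ω s => X (min s u) ω - X u ω) := comap_measurable _
  have h1 := (measurable_pi_iff.1 h r).sub (measurable_pi_iff.1 h s)
  simp only [min_eq_left hr, min_eq_left hs] at h1
  convert h1 using 2 with ω
  simp

theorem comap_pi_le {Ω ι : Type*} {m : MeasurableSpace Ω} {f : Ω → ι → ℝ}
    (hf : ∀ i, Measurable fun ω => f ω i) : MeasurableSpace.comap f MeasurableSpace.pi ≤ m :=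
  (measurable_pi_lambda _ hf).comap_le

theorem pastSigma_mono {Ω : Type*} (X : ℝ → Ω → ℝ) : Monotone (pastSigma X) := fun _ _ huv =>
  comap_pi_le fun _ => measurable_sub_pastSigma X ((min_le_right _ _).trans huv) huv

variable {Ω : Type*} [MeasurableSpace Ω] {P : Measure Ω} {X : ℝ → Ω → ℝ}

theorem IsTwoSidedLevyProcess.pastSigma_le (hX : IsTwoSidedLevyProcess X P) (u : ℝ) :
    pastSigma X u ≤ ‹MeasurableSpace Ω› :=
  comap_pi_le fun _ => (hX.measurable _).sub (hX.measurable _)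

theorem IsTwoSidedLevyProcess.measurable_postPath (hX : IsTwoSidedLevyProcess X P) (u : ℝ) :
    Measurable fun ω => postPath u (fun t => X t ω) :=
  measurable_pi_lambda _ fun _ => (hX.measurable _).sub (hX.measurable _)

/-- An approximation on a lattice of `x` from above. -/
noncomputable def upperApprox (n : ℕ) (x : ℝ) : ℝ :=
  ((⌊((n : ℝ) + 1) * x⌋ : ℝ) + 1) / ((n : ℝ) + 1)

/-- The inequality is strict even at lattice points, so the approximations are decided by the strict
events `{T < u}`. -/
theorem lt_upperApprox (n : ℕ) (x : ℝ) : x < upperApprox n x := by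
  rw [upperApprox, lt_div_iff₀ (by positivity), mul_comm]
  exact Int.lt_floor_add_one _

theorem upperApprox_le (n : ℕ) (x : ℝ) : upperApprox n x ≤ x + 1 / ((n : ℝ) + 1) := by
  rw [upperApprox, div_le_iff₀ (by positivity)]
  have : (x + 1 / ((n : ℝ) + 1)) * ((n : ℝ) + 1) = ((n : ℝ) + 1) * x + 1 := by field_simp
  linarith [Int.floor_le (((n : ℝ) + 1) * x)]

theorem tendsto_upperApprox (x : ℝ) : Tendsto (fun n => upperApprox n x) atTop (𝓝[≥] x) := by
  refine tendsto_nhdsWithin_iff.2 ⟨?_, Eventually.of_forall fun n => (lt_upperApprox n x).le⟩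
  refine tendsto_of_tendsto_of_tendsto_of_le_of_le tendsto_const_nhds ?_
    (fun n => (lt_upperApprox n x).le) (fun n => upperApprox_le n x)
  simpa using (tendsto_const_nhds (x := x)).add (tendsto_one_div_add_atTop_nhds_zero_nat (𝕜 := ℝ))

theorem IsCadlag.tendsto_postPath_upperApprox {f : ℝ → ℝ} (hf : IsCadlag f) (x s : ℝ) :
    Tendsto (fun n => postPath (upperApprox n x) f s) atTop (𝓝 (postPath x f s)) := by
  have h1 := tendsto_upperApprox x
  refine Tendsto.sub ?_ ((hf x).1.tendsto.comp h1)
  refine (hf (x + max s 0)).1.tendsto.comp ?_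
  rw [tendsto_nhdsWithin_iff] at h1 ⊢
  exact ⟨h1.1.add_const _, h1.2.mono fun n hn => by simpa using hn⟩

/-- The approximating time has countably many values, so measurability of each `X t` suffices. -/
theorem IsTwoSidedLevyProcess.measurable_eval_upperApprox (hX : IsTwoSidedLevyProcess X P)
    {T : Ω → ℝ} (hT : Measurable T) (n : ℕ) (s : ℝ) :
    Measurable fun ω => X (upperApprox n (T ω) + s) ω := by
  have h1 : Measurable fun p : ℤ × Ω => X (((p.1 : ℝ) + 1) / ((n : ℝ) + 1) + s) p.2 :=
    measurable_from_prod_countable_right fun j =>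
      hX.measurable (((j : ℝ) + 1) / ((n : ℝ) + 1) + s)
  have h2 : Measurable fun ω => ⌊((n : ℝ) + 1) * T ω⌋ := Int.measurable_floor.comp (hT.const_mul _)
  exact h1.comp (h2.prodMk measurable_id)

theorem IsTwoSidedLevyProcess.measurable_postPath_upperApprox (hX : IsTwoSidedLevyProcess X P)
    {T : Ω → ℝ} (hT : Measurable T) (n : ℕ) :
    Measurable fun ω => postPath (upperApprox n (T ω)) (fun t => X t ω) := by
  refine measurable_pi_lambda _ fun s => (hX.measurable_eval_upperApprox hT n _).sub ?_
  simpa using hX.measurable_eval_upperApprox hT n 0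

theorem IsTwoSidedLevyProcess.measurable_postPath_comp (hX : IsTwoSidedLevyProcess X P)
    {T : Ω → ℝ} (hT : Measurable T) :
    Measurable fun ω => postPath (T ω) (fun t => X t ω) :=
  measurable_pi_lambda _ fun s => measurable_of_tendsto_metrizable
    (fun n => measurable_pi_iff.1 (hX.measurable_postPath_upperApprox hT n) s)
    (tendsto_pi_nhds.2 fun ω => (hX.cadlag ω).tendsto_postPath_upperApprox (T ω) s)

variable [IsProbabilityMeasure P]

/-- The law of the increments from a fixed time does not depend on that time. -/
theorem IsTwoSidedLevyProcess.map_increments (hX : IsTwoSidedLevyProcess X P) (h : ℝ) :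
    P.map (fun ω s => X (h + s) ω - X h ω) = P.map (fun ω s => X s ω - X 0 ω) := by
  have hm := hX.measurable
  refine (map_eq_iff_forall_finset_map_restrict_eq (X := fun s ω => X (h + s) ω - X h ω)
    (Y := fun s ω => X s ω - X 0 ω) ?_ ?_).2 fun I => ?_
  · exact (measurable_pi_lambda _ fun s => (hm _).sub (hm _)).aemeasurable
  · exact (measurable_pi_lambda _ fun s => (hm _).sub (hm _)).aemeasurable
  obtain ⟨τ, hτ, hcov⟩ := exists_monotone_seq_covering (S := insert 0 I) ⟨0, by simp⟩
  obtain ⟨j, hj⟩ := hcov 0 (by simp)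
  choose idx hidx using fun i : I => hcov i (by simp)
  -- Both families are the same function of the successive increments along `τ`, whose joint law is
  -- a product of marginals fixed by stationarity. Index `j` is the position of time `0`.
  let Φ : (ℕ → ℝ) → I → ℝ := fun d i =>
    ∑ k ∈ Finset.range (idx i), d k - ∑ k ∈ Finset.range j, d k
  have hΦ : Measurable Φ := by fun_prop
  have hA : (fun ω => I.restrict fun s => X (h + s) ω - X h ω) =
      Φ ∘ fun ω k => X (h + τ (k + 1)) ω - X (h + τ k) ω := by
    ext ω i
    simp only [Φ, Function.comp_apply, Finset.restrict]
    rw [Finset.sum_range_sub (fun k => X (h + τ k) ω), Finset.sum_range_sub (fun k => X (h + τ k) ω),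
      hidx, hj, add_zero]
    ring
  have hB : (fun ω => I.restrict fun s => X s ω - X 0 ω) =
      Φ ∘ fun ω k => X (τ (k + 1)) ω - X (τ k) ω := by
    ext ω i
    simp only [Φ, Function.comp_apply, Finset.restrict]
    rw [Finset.sum_range_sub (fun k => X (τ k) ω), Finset.sum_range_sub (fun k => X (τ k) ω),
      hidx, hj]
    ring
  rw [hA, hB, ← Measure.map_map hΦ (by fun_prop), ← Measure.map_map hΦ (by fun_prop)]
  congr 1
  have h1 := hX.indep_increments.nat (t := fun k => h + τ k) (fun a b hab => by
    have := hτ hab; simpa using this)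
  have h2 := hX.indep_increments.nat hτ
  rw [iIndepFun_iff_map_fun_eq_infinitePi_map (by fun_prop)] at h1 h2
  rw [h1, h2]
  congr 1
  ext1 k
  simpa [add_comm] using hX.stationary_increments (τ k) (τ (k + 1)) h (hτ k.le_succ)

theorem IsTwoSidedLevyProcess.map_postPath (hX : IsTwoSidedLevyProcess X P) (u : ℝ) :
    P.map (fun ω => postPath u (fun t => X t ω)) = P.map (fun ω => postPath 0 (fun t => X t ω)) := by
  have hm := hX.measurable
  have hΦ : Measurable fun (g : ℝ → ℝ) (s : ℝ) => g (max s 0) := by fun_prop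
  have h := congrArg (Measure.map fun (g : ℝ → ℝ) (s : ℝ) => g (max s 0)) (hX.map_increments u)
  rw [Measure.map_map hΦ (by fun_prop), Measure.map_map hΦ (by fun_prop)] at h
  have h0 : (fun ω => postPath 0 (fun t => X t ω)) = fun ω s => X (max s 0) ω - X 0 ω := by
    ext ω s
    simp [postPath]
  rw [h0]
  exact h

/-- The increments after `u` are independent of those before `u`. -/
theorem IsTwoSidedLevyProcess.indep_pastSigma (hX : IsTwoSidedLevyProcess X P) (u : ℝ) :
    Indep (pastSigma X u)
      (MeasurableSpace.comap (fun ω => postPath u (fun t => X t ω)) MeasurableSpace.pi) P := by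
  have hm := hX.measurable
  refine IndepFun.process_indepFun_process (X := fun s ω => X (min s u) ω - X u ω)
    (Y := fun s ω => postPath u (fun t => X t ω) s) (fun s => (hm _).sub (hm _))
    (fun s => (hm _).sub (hm _)) fun I J => ?_
  classical
  obtain ⟨τ, hτ, hcov⟩ := exists_monotone_seq_covering
    (S := insert u (I.image (fun s => min s u) ∪ J.image fun s => u + max s 0)) ⟨u, by simp⟩
  obtain ⟨j, hj⟩ := hcov u (by simp)
  let δ : ℕ → Ω → ℝ := fun k ω => X (τ (k + 1)) ω - X (τ k) ω
  have hδ : iIndepFun δ P := hX.indep_increments.nat hτ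
  have hδm : ∀ k, Measurable (δ k) := fun k => (hm _).sub (hm _)
  -- Since `τ j = u`, the increments with index below `j` make up the past and those with index at
  -- least `j` the future.
  have hind := indep_iSup_of_disjoint (S := Set.Iio j) (T := Set.Ici j)
    (fun k => (hδm k).comap_le) hδ (Set.disjoint_left.2 fun k hk hk' => by
      rw [Set.mem_Iio] at hk; rw [Set.mem_Ici] at hk'; omega)
  have hsum : ∀ (S : Set ℕ) (a b : ℕ), a ≤ b → (∀ k, a ≤ k → k < b → k ∈ S) →
      Measurable[⨆ k ∈ S, MeasurableSpace.comap (δ k) inferInstance]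
        (fun ω => X (τ b) ω - X (τ a) ω) := by
    intro S a b hab hS
    have : (fun ω => X (τ b) ω - X (τ a) ω) = fun ω => ∑ k ∈ Finset.Ico a b, δ k ω := by
      ext ω
      rw [Finset.sum_Ico_sub (fun k => X (τ k) ω) hab]
    rw [this]
    refine Finset.measurable_sum _ fun k hk => ?_
    rw [Finset.mem_Ico] at hk
    exact (comap_measurable (δ k)).mono
      (le_iSup₂ (f := fun k (_ : k ∈ S) => MeasurableSpace.comap (δ k) inferInstance)
        k (hS k hk.1 hk.2)) le_rfl
  refine indep_of_indep_of_le_left (indep_of_indep_of_le_right hind ?_) ?_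
  · refine comap_pi_le fun i => ?_
    obtain ⟨a, ha⟩ := hcov (u + max (i : ℝ) 0)
      (Finset.mem_insert_of_mem (Finset.mem_union_right _ (Finset.mem_image_of_mem _ i.2)))
    simp only [postPath, ← ha]
    rw [← hj] at ha ⊢
    rcases le_total j a with hja | hja
    · exact hsum _ _ _ hja fun k hk _ => hk
    · have : τ a = τ j := le_antisymm (hτ hja) (by rw [ha]; simp)
      simp [this]
  · refine comap_pi_le fun i => ?_
    obtain ⟨a, ha⟩ := hcov (min (i : ℝ) u)
      (Finset.mem_insert_of_mem (Finset.mem_union_left _ (Finset.mem_image_of_mem _ i.2)))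
    simp only [← ha]
    rw [← hj] at ha ⊢
    rcases le_total a j with hja | hja
    · have := (hsum (Set.Iio j) _ _ hja fun k _ hk => hk).neg
      convert this using 1
      ext ω
      simp
    · have : τ a = τ j := le_antisymm (by rw [ha]; simp) (hτ hja)
      simp [this]

theorem IsTwoSidedLevyProcess.measure_inter_postPath (hX : IsTwoSidedLevyProcess X P) {u : ℝ}
    {A : Set Ω} (hA : MeasurableSet[pastSigma X u] A) {B : Set (ℝ → ℝ)} (hB : MeasurableSet B) :
    P (A ∩ {ω | postPath u (fun t => X t ω) ∈ B}) =
      P A * P {ω | postPath 0 (fun t => X t ω) ∈ B} := by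
  refine ((Indep_iff _ _ P).1 (hX.indep_pastSigma u) A _ hA ⟨B, hB, rfl⟩).trans ?_
  rw [← Measure.map_apply (hX.measurable_postPath u) hB, hX.map_postPath u,
    Measure.map_apply (hX.measurable_postPath 0) hB]
  rfl

/-! ### The strong Markov property -/

/-- Partition according to the value of `k` and use independence at each deterministic time `c j`.
-/
theorem IsTwoSidedLevyProcess.measure_inter_postPath_of_discrete (hX : IsTwoSidedLevyProcess X P)
    {E : Set Ω} {k : Ω → ℤ} {c : ℤ → ℝ}
    (hE : ∀ j, MeasurableSet[pastSigma X (c j)] (E ∩ {ω | k ω = j}))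
    {B : Set (ℝ → ℝ)} (hB : MeasurableSet B) :
    P (E ∩ {ω | postPath (c (k ω)) (fun t => X t ω) ∈ B}) =
      P E * P {ω | postPath 0 (fun t => X t ω) ∈ B} := by
  have hdisj : Pairwise (Function.onFun Disjoint fun j : ℤ => E ∩ {ω | k ω = j}) := by
    intro i j hij
    exact Set.disjoint_left.2 fun ω h1 h2 => hij (h1.2.symm.trans h2.2)
  have hE1 : E = ⋃ j : ℤ, E ∩ {ω | k ω = j} := by
    ext ω; simp
  have hE2 : E ∩ {ω | postPath (c (k ω)) (fun t => X t ω) ∈ B} =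
      ⋃ j : ℤ, (E ∩ {ω | k ω = j}) ∩ {ω | postPath (c j) (fun t => X t ω) ∈ B} := by
    ext ω
    simp only [Set.mem_inter_iff, Set.mem_ofPred_eq, Set.mem_iUnion]
    constructor
    · rintro ⟨h1, h2⟩
      exact ⟨k ω, ⟨h1, rfl⟩, h2⟩
    · rintro ⟨j, ⟨h1, rfl⟩, h2⟩
      exact ⟨h1, h2⟩
  have hmE : ∀ j, MeasurableSet (E ∩ {ω | k ω = j}) := fun j => hX.pastSigma_le _ _ (hE j)
  conv_rhs => rw [hE1]
  have hmB : ∀ j, MeasurableSet {ω | postPath (c j) (fun t => X t ω) ∈ B} :=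
    fun j => hX.measurable_postPath _ hB
  rw [hE2, measure_iUnion (fun i j hij => (hdisj hij).mono Set.inter_subset_left
    Set.inter_subset_left) (fun j => (hmE j).inter (hmB j)),
    measure_iUnion hdisj hmE, ← ENNReal.tsum_mul_right]
  exact tsum_congr fun j => hX.measure_inter_postPath (hE j) hB

/-- The **strong Markov property**: the post-`T` process is independent of the events decided by
time `T`, and has the law of the process after time `0`. -/
theorem IsTwoSidedLevyProcess.strongMarkov (hX : IsTwoSidedLevyProcess X P)
    {T : Ω → ℝ} (hT : Measurable T) {E : Set Ω}
    (hE : ∀ u, MeasurableSet[pastSigma X u] (E ∩ {ω | T ω < u}))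
    {B : Set (ℝ → ℝ)} (hB : MeasurableSet B) :
    P (E ∩ {ω | postPath (T ω) (fun t => X t ω) ∈ B}) =
      P E * P {ω | postPath 0 (fun t => X t ω) ∈ B} := by
  have hmE : MeasurableSet E := by
    have : E = ⋃ n : ℕ, E ∩ {ω | T ω < n} := by
      ext ω
      simpa using fun _ => exists_nat_gt (T ω)
    rw [this]
    exact MeasurableSet.iUnion fun n => hX.pastSigma_le _ _ (hE n)
  have happrox : ∀ n : ℕ, (P.restrict E).map
      (fun ω => postPath (upperApprox n (T ω)) (fun t => X t ω)) =
      (P E • P).map (fun ω => postPath 0 (fun t => X t ω)) := by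
    intro n
    ext B hB
    have hmn := hX.measurable_postPath_upperApprox hT n
    rw [Measure.map_apply hmn hB, Measure.map_apply (hX.measurable_postPath 0) hB,
      Measure.restrict_apply (hmn hB), Set.inter_comm, Measure.smul_apply, smul_eq_mul]
    refine hX.measure_inter_postPath_of_discrete (k := fun ω => ⌊((n : ℝ) + 1) * T ω⌋)
      (c := fun j => ((j : ℝ) + 1) / ((n : ℝ) + 1)) (fun j => ?_) hB
    have hn : (0 : ℝ) < (n : ℝ) + 1 := by positivity
    -- The event is `j / (n + 1) ≤ T < (j + 1) / (n + 1)`, a difference of events decided by the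
    -- lattice time `(j + 1) / (n + 1)`.
    have : E ∩ {ω | ⌊((n : ℝ) + 1) * T ω⌋ = j} =
        (E ∩ {ω | T ω < ((j : ℝ) + 1) / ((n : ℝ) + 1)}) \
          (E ∩ {ω | T ω < (j : ℝ) / ((n : ℝ) + 1)}) := by
      ext ω
      simp only [Set.mem_inter_iff, Set.mem_ofPred_eq, Set.mem_sdiff, Int.floor_eq_iff,
        lt_div_iff₀ hn, mul_comm (T ω)]
      constructor
      · rintro ⟨h1, h2, h3⟩
        exact ⟨⟨h1, h3⟩, fun h => absurd h.2 (not_lt.2 h2)⟩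
      · rintro ⟨⟨h1, h2⟩, h3⟩
        exact ⟨h1, not_lt.1 fun h => h3 ⟨h1, h⟩, h2⟩
    rw [this]
    refine (hE _).diff (pastSigma_mono X ?_ _ (hE _))
    gcongr
    linarith
  have hlaw : (P.restrict E).map (fun ω => postPath (T ω) (fun t => X t ω)) =
      (P E • P).map (fun ω => postPath 0 (fun t => X t ω)) := by
    have hmT := hX.measurable_postPath_comp hT
    have : IsFiniteMeasure (P E • P) := Measure.smul_finite P (measure_ne_top P E)
    -- Laws on path space are determined by their finite-dimensional marginals. These are tested on
    -- bounded continuous functions, where right-continuity and dominated convergence let the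
    -- lattice times decrease to `T`.
    refine IsProjectiveLimit.unique (P := fun I : Finset ℝ =>
      ((P E • P).map (fun ω => postPath 0 (fun t => X t ω))).map I.restrict) (fun I => ?_) fun I => rfl
    have hr : Measurable (I.restrict : (ℝ → ℝ) → _) := Finset.measurable_restrict I
    have hφr : ∀ (φ : BoundedContinuousFunction (I → ℝ) ℝ) (ν : Measure (ℝ → ℝ)),
        AEStronglyMeasurable (fun g => φ (I.restrict g)) ν := fun φ ν =>
      (φ.continuous.measurable.comp hr).aestronglyMeasurable
    refine ext_of_forall_integral_eq_of_IsFiniteMeasure fun φ => ?_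
    refine tendsto_nhds_unique (f := fun n : ℕ => ∫ ω, φ (I.restrict
      (postPath (upperApprox n (T ω)) (fun t => X t ω))) ∂(P.restrict E)) (l := atTop) ?_ ?_
    · rw [integral_map hr.aemeasurable φ.continuous.aestronglyMeasurable,
        integral_map hmT.aemeasurable (hφr φ _)]
      refine tendsto_integral_of_dominated_convergence (fun _ => ‖φ‖) (fun n => ?_)
        (integrable_const _) (fun n => Eventually.of_forall fun ω => φ.norm_coe_le_norm _)
        (Eventually.of_forall fun ω => ?_)
      · exact (φ.continuous.measurable.comp
          (hr.comp (hX.measurable_postPath_upperApprox hT n))).aestronglyMeasurable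
      · refine (φ.continuous.tendsto _).comp (tendsto_pi_nhds.2 fun i => ?_)
        exact (hX.cadlag ω).tendsto_postPath_upperApprox (T ω) i
    · refine tendsto_const_nhds.congr fun n => ?_
      rw [← happrox n, integral_map hr.aemeasurable φ.continuous.aestronglyMeasurable,
        integral_map (hX.measurable_postPath_upperApprox hT n).aemeasurable
          (hφr φ _)]
  have h : (P.restrict E).map (fun ω => postPath (T ω) (fun t => X t ω)) B =
      (P E • P).map (fun ω => postPath 0 (fun t => X t ω)) B := by rw [hlaw]
  rwa [Measure.map_apply (hX.measurable_postPath_comp hT) hB,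
    Measure.map_apply (hX.measurable_postPath 0) hB,
    Measure.restrict_apply (hX.measurable_postPath_comp hT hB), Set.inter_comm,
    Measure.smul_apply, smul_eq_mul] at h

end

/-! ### Adapted measurability of the next contact point -/

section

theorem measurableSet_and_of_imp {Ω : Type*} {m : MeasurableSpace Ω} {c : Prop} {p : Ω → Prop}
    (h : c → MeasurableSet {ω | p ω}) : MeasurableSet {ω | c ∧ p ω} := by
  by_cases hc : c
  · simpa [hc] using h hc
  · simp [hc]

theorem measurableSet_imp_of_imp {Ω : Type*} {m : MeasurableSpace Ω} {c : Prop} {p : Ω → Prop}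
    (h : c → MeasurableSet {ω | p ω}) : MeasurableSet {ω | c → p ω} := by
  by_cases hc : c
  · simpa [hc] using h hc
  · simp [hc]

theorem measurableSet_exists {Ω ι : Type*} [Countable ι] {m : MeasurableSpace Ω} {p : ι → Ω → Prop}
    (h : ∀ i, MeasurableSet {ω | p i ω}) : MeasurableSet {ω | ∃ i, p i ω} := by
  rw [Set.ofPred_exists]
  exact MeasurableSet.iUnion h

theorem measurableSet_forall {Ω ι : Type*} [Countable ι] {m : MeasurableSpace Ω} {p : ι → Ω → Prop}
    (h : ∀ i, MeasurableSet {ω | p i ω}) : MeasurableSet {ω | ∀ i, p i ω} := by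
  rw [Set.ofPred_forall]
  exact MeasurableSet.iInter h

/-- The rational description uses only increments between times before `u`. The σ-field is left free
so that the same proof serves the past before `u`, the full σ-field and path space. -/
theorem measurableSet_nextPoint_contactCloseds_lt {Ω : Type*} {m : MeasurableSpace Ω}
    {Z : ℝ → Ω → ℝ} (hZ : ∀ ω, IsCadlag fun t => Z t ω) {u : ℝ}
    (hm : ∀ r s, r ≤ u → s ≤ u → Measurable fun ω => Z r ω - Z s ω) {s x : ℝ} (hx : x ≤ u) :
    MeasurableSet {ω | nextPoint s (contactCloseds 0 (fun t => Z t ω) (hZ ω)) < x} := by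
  have : {ω | nextPoint s (contactCloseds 0 (fun t => Z t ω) (hZ ω)) < x} =
      {ω | ∃ a b : ℚ, (s < a ∧ (b : ℝ) < x ∧ a < b) ∧ ∀ p : ℚ, p ≤ a → ∀ n : ℕ,
        ∃ q : ℚ, (a < q ∧ q < b) ∧ Z q ω - Z p ω < 1 / ((n : ℝ) + 1)} := by
    ext ω
    exact nextPoint_lt_coe_iff.trans ((hZ ω).exists_mem_contactSet_iff s x)
  rw [this]
  refine measurableSet_exists fun a => measurableSet_exists fun b =>
    measurableSet_and_of_imp fun hab => measurableSet_forall fun p =>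
    measurableSet_imp_of_imp fun hp => measurableSet_forall fun n => measurableSet_exists fun q =>
    measurableSet_and_of_imp fun hq => measurableSet_lt (hm _ _ ?_ ?_) measurable_const
  · have : (q : ℝ) < b := by exact_mod_cast hq.2
    linarith
  · have h1 : (p : ℝ) ≤ a := by exact_mod_cast hp
    have h2 : (a : ℝ) < b := by exact_mod_cast hab.2.2
    linarith

/-- Fatou's lemma for sets: `S` lies in the lower limit of the `A k`. No measurability is needed. -/
theorem measure_le_of_forall_eventually_mem {Ω : Type*} [MeasurableSpace Ω] {P : Measure Ω}
    {S : Set Ω} {A : ℕ → Set Ω} {c : ENNReal} (hS : ∀ ω ∈ S, ∀ᶠ k in atTop, ω ∈ A k)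
    (hA : ∀ k, P (A k) ≤ c) : P S ≤ c := by
  have hmono : Monotone fun n : ℕ => ⋂ k ≥ n, A k := fun a b hab =>
    Set.biInter_subset_biInter_left fun k hk => le_trans hab hk
  have hsub : S ⊆ ⋃ n : ℕ, ⋂ k ≥ n, A k := fun ω hω => by
    obtain ⟨n, hn⟩ := eventually_atTop.1 (hS ω hω)
    exact Set.mem_iUnion.2 ⟨n, Set.mem_iInter₂.2 hn⟩
  refine (measure_mono hsub).trans ?_
  rw [hmono.measure_iUnion]
  exact iSup_le fun n => (measure_mono (Set.biInter_subset_of_mem (le_refl n))).trans (hA n)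

/-! ### Quasi-left-continuity -/

variable {Ω : Type*} [MeasurableSpace Ω] {P : Measure Ω} {X : ℝ → Ω → ℝ}

theorem IsTwoSidedLevyProcess.measurable_of_stopping (hX : IsTwoSidedLevyProcess X P)
    {T : Ω → EReal} (hT : ∀ u : ℝ, MeasurableSet[pastSigma X u] {ω | T ω < u}) : Measurable T :=
  measurable_ereal_of_lt_coe fun u => hX.pastSigma_le u _ (hT u)

variable [IsProbabilityMeasure P]

/-- The strong Markov property at a possibly infinite time. -/
theorem IsTwoSidedLevyProcess.strongMarkov_ereal (hX : IsTwoSidedLevyProcess X P)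
    {T : Ω → EReal} (hbot : ∀ ω, T ω ≠ ⊥) (hT : Measurable T) {E : Set Ω}
    (hE : ∀ u : ℝ, MeasurableSet[pastSigma X u] (E ∩ {ω | T ω < u}))
    {B : Set (ℝ → ℝ)} (hB : MeasurableSet B) :
    P ((E ∩ {ω | T ω ≠ ⊤}) ∩ {ω | postPath (T ω).toReal (fun t => X t ω) ∈ B}) =
      P (E ∩ {ω | T ω ≠ ⊤}) * P {ω | postPath 0 (fun t => X t ω) ∈ B} := by
  refine hX.strongMarkov hT.ereal_toReal (fun u => ?_) hB
  -- Because `toReal` sends `⊤` to `0`, infinite times must be removed before comparing.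
  have : E ∩ {ω | T ω ≠ ⊤} ∩ {ω | (T ω).toReal < u} = E ∩ {ω | T ω < u} := by
    ext ω
    simp only [Set.mem_inter_iff, Set.mem_ofPred_eq, and_assoc]
    refine and_congr_right fun _ => ?_
    constructor
    · rintro ⟨h1, h2⟩
      rwa [← EReal.coe_toReal h1 (hbot ω), EReal.coe_lt_coe_iff]
    · intro h
      have h1 : T ω ≠ ⊤ := (h.trans (EReal.coe_lt_top u)).ne
      rw [← EReal.coe_toReal h1 (hbot ω), EReal.coe_lt_coe_iff] at h
      exact ⟨h1, h⟩
  rw [this]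
  exact hE u

/-- Paths that move by more than `ε` within time `δ`. -/
def oscillating (ε δ : ℝ) : Set (ℝ → ℝ) := {g | ∃ q : ℚ, (0 < (q : ℝ) ∧ (q : ℝ) < δ) ∧ ε < |g q|}

theorem measurableSet_oscillating (ε δ : ℝ) : MeasurableSet (oscillating ε δ) :=
  measurableSet_exists fun q => measurableSet_and_of_imp fun _ =>
    measurableSet_lt measurable_const (measurable_pi_apply (q : ℝ)).abs

/-- Right-continuity at `0` leaves no path in all of these decreasing events. -/
theorem IsTwoSidedLevyProcess.tendsto_measure_oscillating (hX : IsTwoSidedLevyProcess X P)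
    {ε : ℝ} (hε : 0 < ε) :
    Tendsto (fun j : ℕ => P {ω | postPath 0 (fun t => X t ω) ∈ oscillating ε (1 / ((j : ℝ) + 1))})
      atTop (𝓝 0) := by
  have hempty :
      ⋂ j : ℕ, {ω | postPath 0 (fun t => X t ω) ∈ oscillating ε (1 / ((j : ℝ) + 1))} = ∅ := by
    refine Set.eq_empty_of_forall_notMem fun ω hω => ?_
    have hc := (isCadlag_postPath (hX.cadlag ω) 0 0).1
    have h1 : ∀ᶠ s in 𝓝[≥] (0 : ℝ), |postPath 0 (fun t => X t ω) s| < ε := by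
      refine hc.abs.tendsto.eventually (gt_mem_nhds ?_)
      simpa [postPath] using hε
    obtain ⟨d, hd, hsub⟩ := mem_nhdsGE_iff_exists_Ico_subset.1 h1
    obtain ⟨j, hj⟩ := exists_nat_one_div_lt (Set.mem_Ioi.1 hd)
    obtain ⟨q, ⟨hq1, hq2⟩, hq3⟩ := Set.mem_iInter.1 hω j
    exact absurd (hsub ⟨hq1.le, hq2.trans hj⟩) (not_lt.2 hq3.le)
  rw [← measure_empty (μ := P), ← hempty]
  refine tendsto_measure_iInter_atTop (fun j => ?_) (fun i j hij ω hω => ?_) ⟨0, measure_ne_top _ _⟩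
  · exact (hX.measurable_postPath 0 (measurableSet_oscillating _ _)).nullMeasurableSet
  · obtain ⟨q, ⟨hq1, hq2⟩, hq3⟩ := hω
    exact ⟨q, ⟨hq1, hq2.trans_le (by gcongr)⟩, hq3⟩

/-- Just before `D` the path is less than `ε / 2` above its left limit, just after `D` more than `ε`
above it. -/
theorem IsCadlag.postPath_mem_oscillating {f : ℝ → ℝ} (hf : IsCadlag f) {D ε δ : ℝ} (hδ : 0 < δ)
    (hε : 0 < ε) (hjump : Function.leftLim f D + ε < f D) :
    ∀ᶠ x in 𝓝[<] D, postPath x f ∈ oscillating (ε / 2) δ := by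
  have h1 : ∀ᶠ s in 𝓝[>] D, Function.leftLim f D + ε < f s :=
    ((hf D).1.eventually (lt_mem_nhds hjump)).filter_mono
      (nhdsWithin_mono _ Set.Ioi_subset_Ici_self)
  obtain ⟨d, hd, hsub⟩ := mem_nhdsGT_iff_exists_Ioo_subset.1 h1
  have h2 : ∀ᶠ x in 𝓝[<] D, f x < Function.leftLim f D + ε / 2 :=
    (hf.tendsto_leftLim D).eventually (gt_mem_nhds (by linarith))
  filter_upwards [h2, self_mem_nhdsWithin,
    mem_nhdsWithin_of_mem_nhds (lt_mem_nhds (show D - δ < D by linarith))] with x hx1 hx2 hx3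
  rw [Set.mem_Iio] at hx2
  rw [Set.mem_Ioi] at hd
  have hx3' : D - δ < x := hx3
  obtain ⟨q, hq1, hq2⟩ := exists_rat_btwn (show D - x < min δ (d - x) from
    lt_min (by linarith) (by linarith))
  have hq3 := hq2.trans_le (min_le_left _ _)
  have hq4 := hq2.trans_le (min_le_right _ _)
  refine ⟨q, ⟨by linarith, hq3⟩, ?_⟩
  have h3 : Function.leftLim f D + ε < f (x + q) := hsub ⟨by linarith, by linarith⟩
  rw [postPath, max_eq_left (by linarith)]
  exact lt_of_lt_of_le (by linarith) (le_abs_self _)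

/-- A Lévy process has no upward jump at a time announced by stopping times. -/
theorem IsTwoSidedLevyProcess.ae_le_leftLim_of_announced (hX : IsTwoSidedLevyProcess X P)
    {T : ℕ → Ω → EReal} (hbot : ∀ k ω, T k ω ≠ ⊥)
    (hT : ∀ k (u : ℝ), MeasurableSet[pastSigma X u] {ω | T k ω < u})
    {D : Ω → ℝ} {G : Set Ω} (hlt : ∀ ω ∈ G, ∀ k, T k ω < D ω)
    (hlim : ∀ ω ∈ G, ∀ x < D ω, ∀ᶠ k in atTop, (x : EReal) ≤ T k ω) :
    ∀ᵐ ω ∂P, ω ∈ G → X (D ω) ω ≤ Function.leftLim (fun t => X t ω) (D ω) := by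
  have key : ∀ m : ℕ, P {ω | ω ∈ G ∧
      Function.leftLim (fun t => X t ω) (D ω) + 1 / ((m : ℝ) + 1) < X (D ω) ω} = 0 := by
    intro m
    set ε : ℝ := 1 / ((m : ℝ) + 1) with hεdef
    have hε : 0 < ε := by positivity
    -- By the strong Markov property at the announcing times, the jump event is bounded, for every
    -- `j`, by the probability of oscillating by `ε / 2` within time `1 / (j + 1)`.
    refine le_antisymm (ge_of_tendsto (hX.tendsto_measure_oscillating (half_pos hε))
      (Eventually.of_forall fun j => ?_)) bot_le
    set B := oscillating (ε / 2) (1 / ((j : ℝ) + 1))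
    let A : ℕ → Set Ω := fun k => (Set.univ ∩ {ω | T k ω ≠ ⊤}) ∩
      {ω | postPath (T k ω).toReal (fun t => X t ω) ∈ B}
    have hA : ∀ k, P (A k) ≤ P {ω | postPath 0 (fun t => X t ω) ∈ B} := by
      intro k
      rw [hX.strongMarkov_ereal (hbot k) (hX.measurable_of_stopping (hT k))
        (fun u => by rw [Set.univ_inter]; exact hT k u) (measurableSet_oscillating _ _)]
      exact mul_le_of_le_one_left' prob_le_one
    refine measure_le_of_forall_eventually_mem (A := A) ?_ hA
    · rintro ω ⟨hG, hjump⟩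
      have hfin : ∀ k, T k ω ≠ ⊤ := fun k => ((hlt ω hG k).trans (EReal.coe_lt_top _)).ne
      have hco : ∀ k, (((T k ω).toReal : ℝ) : EReal) = T k ω := fun k =>
        EReal.coe_toReal (hfin k) (hbot k ω)
      have h1 : Tendsto (fun k => (T k ω).toReal) atTop (𝓝[<] (D ω)) := by
        refine tendsto_nhdsWithin_iff.2 ⟨tendsto_order.2 ⟨fun x hx => ?_, fun x hx => ?_⟩, ?_⟩
        · obtain ⟨y, hxy, hy⟩ := exists_between hx
          filter_upwards [hlim ω hG y hy] with k hk
          rw [← hco k, EReal.coe_le_coe_iff] at hk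
          linarith
        · refine Eventually.of_forall fun k => ?_
          have := hlt ω hG k
          rw [← hco k, EReal.coe_lt_coe_iff] at this
          linarith
        · refine Eventually.of_forall fun k => ?_
          have := hlt ω hG k
          rwa [← hco k, EReal.coe_lt_coe_iff] at this
      filter_upwards [h1.eventually ((hX.cadlag ω).postPath_mem_oscillating
        (δ := 1 / ((j : ℝ) + 1)) (by positivity) hε hjump)] with k hk
      exact ⟨⟨trivial, hfin k⟩, hk⟩
  have hall : ∀ᵐ ω ∂P, ∀ m : ℕ, ¬ (ω ∈ G ∧
      Function.leftLim (fun t => X t ω) (D ω) + 1 / ((m : ℝ) + 1) < X (D ω) ω) :=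
    ae_all_iff.2 fun m => by rw [ae_iff]; simpa using key m
  filter_upwards [hall] with ω hω hG
  by_contra! hlt'
  obtain ⟨m, hm⟩ := exists_nat_one_div_lt (sub_pos.2 hlt')
  exact hω m ⟨hG, by linarith⟩

/-- A deterministic time is announced by the constants `t - 1 / (k + 1)`. -/
theorem IsTwoSidedLevyProcess.ae_le_leftLim (hX : IsTwoSidedLevyProcess X P) (t : ℝ) :
    ∀ᵐ ω ∂P, X t ω ≤ Function.leftLim (fun t => X t ω) t := by
  have h := hX.ae_le_leftLim_of_announced
    (T := fun k _ => ((t - 1 / ((k : ℝ) + 1) : ℝ) : EReal)) (D := fun _ => t) (G := Set.univ)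
    (fun k ω => EReal.coe_ne_bot _) (fun k u => MeasurableSet.const _)
    (fun ω _ k => ?_) (fun ω _ x hx => ?_)
  · simpa using h
  · rw [EReal.coe_lt_coe_iff]
    have : (0 : ℝ) < 1 / ((k : ℝ) + 1) := by positivity
    linarith
  · filter_upwards [(tendsto_one_div_add_atTop_nhds_zero_nat (𝕜 := ℝ)).eventually
      (gt_mem_nhds (sub_pos.2 hx))] with k hk
    rw [EReal.coe_le_coe_iff]
    linarith

/-! ### No upward jump at the next contact point -/

/-- The rational times after `t` at which the path is at most `1 / (k + 1)` above its past. -/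
def nearContact (t : ℝ) (k : ℕ) (f : ℝ → ℝ) : Set ℚ :=
  {q | t < q ∧ ∀ p : ℚ, (p : ℝ) ≤ t → f q - f p ≤ 1 / ((k : ℝ) + 1)}

/-- The infimum of `nearContact t k f`. -/
noncomputable def nearContactTime (t : ℝ) (k : ℕ) (f : ℝ → ℝ) : EReal :=
  ⨅ (q : ℚ) (_ : q ∈ nearContact t k f), ((q : ℝ) : EReal)

theorem nearContactTime_lt_iff {t : ℝ} {k : ℕ} {f : ℝ → ℝ} {x : EReal} :
    nearContactTime t k f < x ↔ ∃ q ∈ nearContact t k f, ((q : ℝ) : EReal) < x := by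
  simp only [nearContactTime, iInf_lt_iff, exists_prop]

theorem le_nearContactTime (t : ℝ) (k : ℕ) (f : ℝ → ℝ) : (t : EReal) ≤ nearContactTime t k f :=
  le_iInf₂ fun _ hq => EReal.coe_le_coe_iff.2 hq.1.le

theorem measurableSet_nearContactTime_lt {Ω' : Type*} (X : ℝ → Ω' → ℝ) (t : ℝ) (k : ℕ) (u : ℝ) :
    MeasurableSet[pastSigma X u] {ω | nearContactTime t k (fun s => X s ω) < u} := by
  have : {ω | nearContactTime t k (fun s => X s ω) < u} = {ω | ∃ q : ℚ, (t < q ∧ (q : ℝ) < u) ∧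
      ∀ p : ℚ, (p : ℝ) ≤ t → X q ω - X p ω ≤ 1 / ((k : ℝ) + 1)} := by
    ext ω
    simp only [Set.mem_ofPred_eq, nearContactTime_lt_iff, nearContact, EReal.coe_lt_coe_iff]
    exact exists_congr fun q => by tauto
  rw [this]
  let _ := pastSigma X u
  refine measurableSet_exists fun q => measurableSet_and_of_imp fun hq =>
    measurableSet_forall fun p => measurableSet_imp_of_imp fun hp =>
    measurableSet_le (measurable_sub_pastSigma X hq.2.le (by linarith)) measurable_const

/-- With an upward jump the contact value is the left limit, so the path is already close to it
strictly before `D`. -/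
theorem IsCadlag.nearContactTime_lt {f : ℝ → ℝ} (hf : IsCadlag f) {t D : ℝ} (htD : t < D)
    (hD : D ∈ contactSet 0 f) (hjump : Function.leftLim f D < f D) (k : ℕ) :
    nearContactTime t k f < D := by
  rw [mem_contactSet_zero_iff hf, lowerEnv, min_eq_right hjump.le] at hD
  obtain ⟨q, hq1, hq2, hq3⟩ := hf.exists_rat_lt_of_leftLim_lt htD
    (lt_add_of_pos_right _ (by positivity : (0 : ℝ) < 1 / ((k : ℝ) + 1)))
  refine nearContactTime_lt_iff.2 ⟨q, ⟨hq1, fun p hp => ?_⟩, EReal.coe_lt_coe_iff.2 hq2⟩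
  linarith [hD p (hp.trans htD.le)]

/-- Otherwise the path would come arbitrarily close to its infimum before `t` within `[t, x]`, and
the minimum there would be a contact point. -/
theorem IsCadlag.eventually_le_nearContactTime {f : ℝ → ℝ} (hf : IsCadlag f) {t x : ℝ}
    (hno : ∀ s ∈ contactSet 0 f, t ≤ s → x < s) :
    ∀ᶠ k in atTop, (x : EReal) ≤ nearContactTime t k f := by
  by_contra hcon
  -- The sets `nearContact t k f` decrease in `k`, so infinitely many indices give all of them.
  have hall : ∀ k, ∃ q ∈ nearContact t k f, (q : ℝ) < x := by
    intro k
    obtain ⟨n, hkn, hn⟩ := frequently_atTop.1 (not_eventually.1 hcon) k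
    obtain ⟨q, hq, hqx⟩ := nearContactTime_lt_iff.1 (not_le.1 hn)
    exact ⟨q, ⟨hq.1, fun p hp => (hq.2 p hp).trans (by gcongr)⟩, EReal.coe_lt_coe_iff.1 hqx⟩
  obtain ⟨q₀, hq₀, hq₀x⟩ := hall 0
  obtain ⟨s, hs, hmin⟩ := hf.exists_isMinOn_lowerEnv (hq₀.1.trans hq₀x).le
  refine absurd (hno s (hf.mem_contactSet_of_isMinOn hs hmin fun p hp => ?_) hs.1) (not_lt.2 hs.2)
  refine le_of_forall_pos_lt_add fun ε hε => ?_
  obtain ⟨n, hn⟩ := exists_nat_one_div_lt hε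
  obtain ⟨q, hq, hqx⟩ := hall n
  have h1 := (hmin q ⟨hq.1.le, hqx.le⟩).trans (lowerEnv_le f q)
  linarith [hq.2 p hp.le]

theorem IsTwoSidedLevyProcess.ae_le_leftLim_nextPoint_of_notMem (hX : IsTwoSidedLevyProcess X P)
    (t : ℝ) : ∀ᵐ ω ∂P, t ∉ contactSet 0 (fun s => X s ω) → ∀ D : ℝ,
      nextPoint t (contactCloseds 0 (fun s => X s ω) (hX.cadlag ω)) = D →
      X D ω ≤ Function.leftLim (fun s => X s ω) D := by
  let H : Ω → Closeds ℝ := fun ω => contactCloseds 0 (fun s => X s ω) (hX.cadlag ω)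
  let D : Ω → ℝ := fun ω => (nextPoint t (H ω)).toReal
  have h := hX.ae_le_leftLim_of_announced
    (T := fun k ω => nearContactTime t k (fun s => X s ω)) (D := D)
    -- The jump itself is part of `G`: the next point is only known to be announced when it is an
    -- upward jump, and the conclusion then contradicts membership in `G`.
    (G := {ω | t ∉ H ω ∧ nextPoint t (H ω) = D ω ∧
      Function.leftLim (fun s => X s ω) (D ω) < X (D ω) ω})
    (fun k ω => ((EReal.bot_lt_coe t).trans_le (le_nearContactTime t k _)).ne')
    (fun k u => measurableSet_nearContactTime_lt X t k u) ?_ ?_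
  · filter_upwards [h] with ω hω ht d hd
    have hDd : D ω = d := by simp only [D, H, hd, EReal.toReal_coe]
    by_contra! hlt
    have := hω ⟨ht, by rw [hDd]; exact hd, by rw [hDd]; exact hlt⟩
    rw [hDd] at this
    exact absurd hlt (not_lt.2 this)
  · rintro ω ⟨ht, hD, hjump⟩ k
    have hmem := mem_of_nextPoint_eq hD
    have hle := le_nextPoint t (H ω)
    rw [hD, EReal.coe_le_coe_iff] at hle
    exact (hX.cadlag ω).nearContactTime_lt
      (lt_of_le_of_ne hle fun h => ht (h ▸ hmem)) hmem hjump k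
  · rintro ω ⟨ht, hD, -⟩ x hx
    refine (hX.cadlag ω).eventually_le_nearContactTime fun s hs hts => ?_
    have hts' : t < s := lt_of_le_of_ne hts fun h => ht (h ▸ hs)
    have := nextPoint_le (w := H ω) hs hts'
    rw [hD, EReal.coe_le_coe_iff] at this
    linarith

/-- If `D = t`, the time is deterministic. If `t < D`, a rational strictly in between is not a
contact point and has the same next point, whether or not `t` itself is in contact. -/
theorem IsTwoSidedLevyProcess.ae_le_leftLim_nextPoint (hX : IsTwoSidedLevyProcess X P) (t : ℝ) :
    ∀ᵐ ω ∂P, ∀ D : ℝ, nextPoint t (contactCloseds 0 (fun s => X s ω) (hX.cadlag ω)) = D →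
      X D ω ≤ Function.leftLim (fun s => X s ω) D := by
  have h := ae_all_iff.2 fun q : ℚ => hX.ae_le_leftLim_nextPoint_of_notMem (q : ℝ)
  filter_upwards [h, hX.ae_le_leftLim t] with ω h1 h2 D hD
  have hle := le_nextPoint t (contactCloseds 0 (fun s => X s ω) (hX.cadlag ω))
  rw [hD, EReal.coe_le_coe_iff] at hle
  rcases hle.eq_or_lt with rfl | hlt
  · exact h2
  · obtain ⟨q, htq, hqD⟩ := exists_rat_btwn hlt
    refine h1 q (fun hq => ?_) D (nextPoint_eq_of_lt hD htq.le hqD)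
    have := nextPoint_le (w := contactCloseds 0 (fun s => X s ω) (hX.cadlag ω)) hq htq
    rw [hD, EReal.coe_le_coe_iff] at this
    linarith

end

section

/-! ### Drift to `-∞` -/

section Truncation

variable {Ω : Type*} [MeasurableSpace Ω] {P : Measure Ω}

theorem ofReal_max_of_nonpos {x y : ℝ} (hy : y ≤ 0) :
    ENNReal.ofReal (max x y) = ENNReal.ofReal x := by
  rw [ENNReal.ofReal_max, ENNReal.ofReal_of_nonpos hy, max_eq_left zero_le]

theorem integrable_max_neg [IsFiniteMeasure P] {Y : Ω → ℝ} (hY : Measurable Y)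
    (hpos : ∫⁻ ω, ENNReal.ofReal (Y ω) ∂P < ⊤) (K : ℕ) :
    Integrable (fun ω => max (Y ω) (-(K : ℝ))) P := by
  have h1 : Integrable (fun ω => max (Y ω) 0) P := by
    refine (lintegral_ofReal_ne_top_iff_integrable (f := fun ω => max (Y ω) 0)
      (hY.max measurable_const).aestronglyMeasurable
      (Eventually.of_forall fun ω => le_max_right _ _)).1 ?_
    simpa only [ofReal_max_of_nonpos (le_refl (0 : ℝ))] using hpos.ne
  refine (h1.add (integrable_const (K : ℝ))).mono' (hY.max measurable_const).aestronglyMeasurable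
    (Eventually.of_forall fun ω => ?_)
  have hK : (0 : ℝ) ≤ K := Nat.cast_nonneg K
  simp only [Pi.add_apply, Real.norm_eq_abs]
  rw [abs_le]
  constructor
  · linarith [le_max_right (Y ω) (-(K : ℝ)), le_max_right (Y ω) 0]
  · exact max_le (by linarith [le_max_left (Y ω) 0]) (by linarith [le_max_right (Y ω) 0])

/-- If all truncated means were at least `α`, monotone convergence would bound the negative part and
give an expectation of at least `α`. -/
theorem exists_integral_max_neg_lt [IsFiniteMeasure P] {Y : Ω → ℝ} (hY : Measurable Y)
    (hpos : ∫⁻ ω, ENNReal.ofReal (Y ω) ∂P < ⊤) {α : ℝ}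
    (hα : extendedExpectation Y P < (α : EReal)) :
    ∃ K : ℕ, ∫ ω, max (Y ω) (-(K : ℝ)) ∂P < α := by
  by_contra! hcon
  set a := ∫⁻ ω, ENNReal.ofReal (Y ω) ∂P with ha
  set b : ℕ → ENNReal := fun K => ∫⁻ ω, ENNReal.ofReal (-max (Y ω) (-(K : ℝ))) ∂P with hb
  have hmeas : ∀ K : ℕ, Measurable fun ω => ENNReal.ofReal (-max (Y ω) (-(K : ℝ))) := fun K =>
    (hY.max measurable_const).neg.ennreal_ofReal
  have hbK : ∀ K, b K ≠ ⊤ := fun K =>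
    (Integrable.lintegral_lt_top (integrable_max_neg hY hpos K).neg).ne
  have hint : ∀ K : ℕ, ∫ ω, max (Y ω) (-(K : ℝ)) ∂P = a.toReal - (b K).toReal := by
    intro K
    rw [integral_eq_lintegral_pos_part_sub_lintegral_neg_part (integrable_max_neg hY hpos K)]
    simp only [ofReal_max_of_nonpos (neg_nonpos.2 (Nat.cast_nonneg K)), ha, hb]
  have hle : ∀ K, b K ≤ ENNReal.ofReal (a.toReal - α) := fun K => by
    rw [← ENNReal.ofReal_toReal (hbK K)]
    exact ENNReal.ofReal_le_ofReal (by linarith [hcon K, hint K])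
  have hnonneg : 0 ≤ a.toReal - α := by
    linarith [hcon 0, hint 0, (ENNReal.toReal_nonneg : 0 ≤ (b 0).toReal)]
  have hlim : Tendsto b atTop (𝓝 (∫⁻ ω, ENNReal.ofReal (-Y ω) ∂P)) := by
    refine lintegral_tendsto_of_tendsto_of_monotone (fun K => (hmeas K).aemeasurable)
      (Eventually.of_forall fun ω K K' hK => ?_) (Eventually.of_forall fun ω => ?_)
    · refine ENNReal.ofReal_le_ofReal (neg_le_neg (max_le_max le_rfl (neg_le_neg ?_)))
      exact_mod_cast hK
    · refine tendsto_const_nhds.congr' ?_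
      obtain ⟨n, hn⟩ := exists_nat_ge (-Y ω)
      filter_upwards [eventually_ge_atTop n] with K hK
      have : (n : ℝ) ≤ K := by exact_mod_cast hK
      rw [max_eq_left (by linarith)]
  have hble : ∫⁻ ω, ENNReal.ofReal (-Y ω) ∂P ≤ ENNReal.ofReal (a.toReal - α) :=
    le_of_tendsto hlim (Eventually.of_forall hle)
  refine absurd hα (not_lt.2 ?_)
  rw [extendedExpectation, ← ha, ← EReal.coe_ennreal_toReal hpos.ne,
    ← EReal.coe_ennreal_toReal (hble.trans_lt ENNReal.ofReal_lt_top).ne, ← EReal.coe_sub,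
    EReal.coe_le_coe_iff]
  have := ENNReal.toReal_mono ENNReal.ofReal_ne_top hble
  rw [ENNReal.toReal_ofReal hnonneg] at this
  linarith

/-- Partial sums of pairwise independent copies of a variable with expectation below `α`, the
expectation being possibly `-∞`. -/
theorem ae_tendsto_sum_atBot [IsFiniteMeasure P] {Y : Ω → ℝ} (hY : Measurable Y)
    (hpos : ∫⁻ ω, ENNReal.ofReal (Y ω) ∂P < ⊤) {α : ℝ}
    (hα : extendedExpectation Y P < (α : EReal)) {ξ : ℕ → Ω → ℝ}
    (hindep : Pairwise fun i j => IndepFun (ξ i) (ξ j) P)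
    (hident : ∀ i, IdentDistrib (ξ i) Y P P) :
    ∀ᵐ ω ∂P, Tendsto (fun n : ℕ => ∑ i ∈ Finset.range n, ξ i ω - α * n) atTop atBot := by
  obtain ⟨K, hK⟩ := exists_integral_max_neg_lt hY hpos hα
  have hm : Measurable fun x : ℝ => max x (-(K : ℝ)) := measurable_id.max measurable_const
  have hid : ∀ i,
      IdentDistrib (fun ω => max (ξ i ω) (-(K : ℝ))) (fun ω => max (Y ω) (-(K : ℝ))) P P :=
    fun i => (hident i).comp hm
  have hlaw := strong_law_ae_real (μ := P) (fun i ω => max (ξ i ω) (-(K : ℝ)))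
    ((hid 0).integrable_iff.2 (integrable_max_neg hY hpos K))
    (fun i j hij => (hindep hij).comp hm hm) (fun i => (hid i).trans (hid 0).symm)
  filter_upwards [hlaw] with ω hω
  rw [(hid 0).integral_eq] at hω
  have h1 : Tendsto (fun n : ℕ => ((∑ i ∈ Finset.range n, max (ξ i ω) (-(K : ℝ))) / n - α) * n)
      atTop atBot :=
    (hω.sub_const α).neg_mul_atTop (sub_neg.2 hK) tendsto_natCast_atTop_atTop
  refine tendsto_atBot_mono' _ ?_ h1
  filter_upwards [eventually_gt_atTop 0] with n hn
  have hn' : (n : ℝ) ≠ 0 := by positivity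
  rw [sub_mul, div_mul_cancel₀ _ hn']
  exact sub_le_sub_right (Finset.sum_le_sum fun i _ => le_max_left _ _) _

end Truncation

variable {Ω : Type*} [MeasurableSpace Ω] {P : Measure Ω} {X : ℝ → Ω → ℝ}

theorem _root_.ProbabilityTheory.HasIndepIncrements.indepFun_of_le_of_le_of_le
    (hX : HasIndepIncrements X P) {a b c d : ℝ} (hab : a ≤ b) (hbc : b ≤ c) (hcd : c ≤ d) :
    IndepFun (fun ω => X b ω - X a ω) (fun ω => X d ω - X c ω) P := by
  let τ : ℕ → ℝ
    | 0 => a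
    | 1 => b
    | 2 => c
    | _ => d
  have hτ : Monotone τ := monotone_nat_of_le_succ fun n => by
    rcases n with _ | _ | _ | n <;> simp [τ, hab, hbc, hcd]
  exact (hX.nat hτ).indepFun (by decide : (0 : ℕ) ≠ 2)

theorem IsTwoSidedLevyProcess.identDistrib_increment (hX : IsTwoSidedLevyProcess X P) {s t : ℝ}
    (hst : t = s + 1) : IdentDistrib (fun ω => X t ω - X s ω) (X 1) P P := by
  have hm := hX.measurable
  refine ⟨((hm _).sub (hm _)).aemeasurable, (hm _).aemeasurable, ?_⟩
  have h := hX.stationary_increments 0 1 s zero_le_one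
  rw [zero_add, add_comm, ← hst] at h
  rw [h]
  refine Measure.map_congr ?_
  filter_upwards [hX.zero] with ω hω
  rw [hω, sub_zero]

variable [IsProbabilityMeasure P]

theorem IsTwoSidedLevyProcess.ae_tendsto_atBot (hX : IsTwoSidedLevyProcess X P)
    (hpos : ∫⁻ ω, ENNReal.ofReal (X 1 ω) ∂P < ⊤) {α : ℝ}
    (hα : extendedExpectation (X 1) P < (α : EReal)) :
    ∀ᵐ ω ∂P, Tendsto (fun n : ℕ => X n ω + -α * n) atTop atBot := by
  have h := ae_tendsto_sum_atBot (hX.measurable 1) hpos hα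
    (ξ := fun (k : ℕ) ω => X ((k + 1 : ℕ) : ℝ) ω - X (k : ℝ) ω)
    (fun i j hij => (hX.indep_increments.nat (t := fun k : ℕ => (k : ℝ)) Nat.mono_cast).indepFun hij)
    (fun i => hX.identDistrib_increment (by push_cast; ring))
  filter_upwards [h, hX.zero] with ω hω h0
  refine hω.congr fun n => ?_
  rw [Finset.sum_range_sub (fun k : ℕ => X (k : ℝ) ω), Nat.cast_zero, h0]
  ring

/-- The backward increments telescope to `-X (-n)`, so the same law of large numbers applies with
the sign reversed. -/
theorem IsTwoSidedLevyProcess.ae_tendsto_atTop (hX : IsTwoSidedLevyProcess X P)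
    (hpos : ∫⁻ ω, ENNReal.ofReal (X 1 ω) ∂P < ⊤) {α : ℝ}
    (hα : extendedExpectation (X 1) P < (α : EReal)) :
    ∀ᵐ ω ∂P, Tendsto (fun n : ℕ => X (-(n : ℝ)) ω + -α * (-(n : ℝ))) atTop atTop := by
  have hlt : ∀ i j : ℕ, i < j →
      IndepFun (fun ω => X (-(j : ℝ)) ω - X (-((j + 1 : ℕ) : ℝ)) ω)
        (fun ω => X (-(i : ℝ)) ω - X (-((i + 1 : ℕ) : ℝ)) ω) P := by
    intro i j hij
    have h1 : ((i + 1 : ℕ) : ℝ) ≤ j := by exact_mod_cast hij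
    refine hX.indep_increments.indepFun_of_le_of_le_of_le ?_ (neg_le_neg h1) ?_ <;>
    · push_cast
      linarith
  have h := ae_tendsto_sum_atBot (hX.measurable 1) hpos hα
    (ξ := fun (k : ℕ) ω => X (-(k : ℝ)) ω - X (-((k + 1 : ℕ) : ℝ)) ω)
    (fun i j hij => by
      rcases lt_or_gt_of_ne hij with hij | hij
      · exact (hlt i j hij).symm
      · exact hlt j i hij)
    (fun i => hX.identDistrib_increment (by push_cast; ring))
  filter_upwards [h, hX.zero] with ω hω h0
  refine (tendsto_neg_atBot_atTop.comp hω).congr fun n => ?_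
  have := Finset.sum_range_sub (fun k : ℕ => -X (-(k : ℝ)) ω) n
  simp only [Nat.cast_zero, neg_zero, h0, neg_sub_neg] at this
  rw [Function.comp_apply, this]
  ring

/-! ### Boundedness of the past -/

/-- A càdlàg path is bounded below on `[0, 1]`, so one `K` serves all `s`; stationarity then makes
it serve all `a`. This is the input to Ottaviani's inequality. -/
theorem IsTwoSidedLevyProcess.exists_half_le_measure (hX : IsTwoSidedLevyProcess X P) :
    ∃ K : ℕ, ∀ a : ℝ, ∀ s ∈ Set.Icc (0 : ℝ) 1,
      1 / 2 ≤ P {ω | -(K : ℝ) ≤ X (s + a) ω - X (0 + a) ω} := by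
  let W : ℕ → Set Ω := fun K => {ω | ∀ s ∈ Set.Icc (0 : ℝ) 1, -(K : ℝ) ≤ X s ω - X 0 ω}
  have hW : Monotone W := fun K K' hK ω hω s hs => by
    have : (K : ℝ) ≤ K' := by exact_mod_cast hK
    linarith [hω s hs]
  have hU : ⋃ K, W K = Set.univ := by
    refine Set.eq_univ_of_forall fun ω => ?_
    obtain ⟨c, hc⟩ := (hX.cadlag ω).exists_forall_le 0 1
    obtain ⟨K, hK⟩ := exists_nat_ge (X 0 ω - c)
    exact Set.mem_iUnion.2 ⟨K, fun s hs => by linarith [hc s hs]⟩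
  have h1 : (1 / 2 : ENNReal) < ⨆ K, P (W K) := by
    rw [← hW.measure_iUnion, hU, measure_univ]
    exact ENNReal.half_lt_self one_ne_zero ENNReal.one_ne_top
  obtain ⟨K, hK⟩ := lt_iSup_iff.1 h1
  refine ⟨K, fun a s hs => ?_⟩
  have hm : ∀ p q, Measurable fun ω => X p ω - X q ω := fun p q =>
    (hX.measurable p).sub (hX.measurable q)
  have h2 := congrArg (fun μ => μ (Set.Ici (-(K : ℝ)))) (hX.stationary_increments 0 s a hs.1)
  rw [Measure.map_apply (hm _ _) measurableSet_Ici,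
    Measure.map_apply (hm _ _) measurableSet_Ici] at h2
  refine hK.le.trans ((measure_mono fun ω hω => ?_).trans h2.ge)
  exact hω s hs

/-- Ottaviani's inequality along the lattice of mesh `1 / (m + 1)`. -/
theorem IsTwoSidedLevyProcess.measure_lattice_le (hX : IsTwoSidedLevyProcess X P) {K : ℕ}
    (hK : ∀ a : ℝ, ∀ s ∈ Set.Icc (0 : ℝ) 1, 1 / 2 ≤ P {ω | -(K : ℝ) ≤ X (s + a) ω - X (0 + a) ω})
    (c : ℝ) (m : ℕ) :
    P {ω | ∃ k : ℕ, X (-(k / ((m : ℝ) + 1))) ω - X 0 ω < -c} ≤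
      2 * P {ω | ∃ n : ℕ, X (-(n : ℝ)) ω - X 0 ω < -c + K} := by
  have hm := hX.measurable
  let a : ℕ → ℝ := fun k => -(k / ((m : ℝ) + 1))
  -- `F k` is first passage below `-c` at the lattice time `a k`, going backwards, and is decided by
  -- increments after `a k`. `G k` concerns the independent increment from the integer just to the
  -- left up to `a k`; on `F k ∩ G k` the value at that integer is below `-c + K` relative to `X 0`.
  let F : ℕ → Set Ω := fun k => {ω | X (a k) ω - X 0 ω < -c ∧ ∀ i < k, -c ≤ X (a i) ω - X 0 ω}
  let G : ℕ → Set Ω := fun k => {ω | -(K : ℝ) ≤ X (a k) ω - X (-(⌈k / ((m : ℝ) + 1)⌉₊ : ℝ)) ω}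
  have hceil : ∀ k : ℕ, -(⌈k / ((m : ℝ) + 1)⌉₊ : ℝ) ≤ a k := fun k => neg_le_neg (Nat.le_ceil _)
  have ha : ∀ i k : ℕ, i ≤ k → a k ≤ a i := fun i k hik => by
    simp only [a]; gcongr
  have ha0 : ∀ k, a k ≤ 0 := fun k => neg_nonpos.2 (by positivity)
  have hFm : ∀ k, MeasurableSet (F k) := fun k =>
    (measurableSet_lt ((hm _).sub (hm _)) measurable_const).inter
      (measurableSet_forall fun i => measurableSet_imp_of_imp fun _ =>
        measurableSet_le measurable_const ((hm _).sub (hm _)))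
  have hGm : ∀ k, MeasurableSet (G k) := fun k =>
    measurableSet_le measurable_const ((hm _).sub (hm _))
  have hG : ∀ k, 1 / 2 ≤ P (G k) := fun k => by
    have h := hK (-(⌈k / ((m : ℝ) + 1)⌉₊ : ℝ)) (a k + ⌈k / ((m : ℝ) + 1)⌉₊) ⟨by linarith [hceil k], by
      have := Nat.ceil_lt_add_one (show (0 : ℝ) ≤ k / ((m : ℝ) + 1) by positivity)
      simp only [a]
      linarith⟩
    simpa [G] using h
  have hind : ∀ k, P (G k ∩ F k) = P (G k) * P (F k) := by
    intro k
    refine (Indep_iff _ _ P).1 (hX.indep_pastSigma (a k)) _ _ ?_ ?_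
    · let _ := pastSigma X (a k)
      exact measurableSet_le measurable_const (measurable_sub_pastSigma X le_rfl (hceil k))
    · have hg : ∀ p q : ℝ, Measurable fun g : ℝ → ℝ => g p - g q := fun p q =>
        (measurable_pi_apply p).sub (measurable_pi_apply q)
      refine ⟨{g | g 0 - g (-a k) < -c ∧ ∀ i < k, -c ≤ g (a i - a k) - g (-a k)}, ?_, ?_⟩
      · exact (measurableSet_lt (hg _ _) measurable_const).inter
          (measurableSet_forall fun i => measurableSet_imp_of_imp fun _ =>
            measurableSet_le measurable_const (hg (a i - a k) (-a k)))
      · ext ω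
        simp only [Set.mem_preimage, Set.mem_ofPred_eq, F, postPath, max_self, add_zero,
          max_eq_left (neg_nonneg.2 (ha0 k)), add_neg_cancel, sub_self, zero_sub, neg_sub]
        refine and_congr_right fun _ => forall₂_congr fun i hi => ?_
        rw [max_eq_left (sub_nonneg.2 (ha i k hi.le)), add_sub_cancel, sub_sub_sub_cancel_right]
  have hdisj : Pairwise (Function.onFun Disjoint F) := by
    have hlt : ∀ i j, i < j → Disjoint (F i) (F j) := fun i j hij =>
      Set.disjoint_left.2 fun ω h1 h2 => absurd h1.1 (not_lt.2 (h2.2 i hij))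
    intro i j hij
    rcases lt_or_gt_of_ne hij with h | h
    · exact hlt i j h
    · exact (hlt j i h).symm
  have hUF : {ω | ∃ k : ℕ, X (-(k / ((m : ℝ) + 1))) ω - X 0 ω < -c} ⊆ ⋃ k, F k := by
    classical
    intro ω hω
    refine Set.mem_iUnion.2 ⟨Nat.find hω, Nat.find_spec hω, fun i hi => ?_⟩
    exact not_lt.1 (Nat.find_min hω hi)
  calc P {ω | ∃ k : ℕ, X (-(k / ((m : ℝ) + 1))) ω - X 0 ω < -c}
      ≤ ∑' k, P (F k) := (measure_mono hUF).trans (measure_iUnion hdisj hFm).le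
    _ ≤ ∑' k, 2 * P (G k ∩ F k) := ENNReal.tsum_le_tsum fun k => by
        rw [hind, ← mul_assoc]
        refine le_mul_of_one_le_left' ?_
        calc (1 : ENNReal) = 2 * (1 / 2) := by
              rw [one_div, ENNReal.mul_inv_cancel two_ne_zero ENNReal.ofNat_ne_top]
          _ ≤ 2 * P (G k) := by gcongr; exact hG k
    _ = 2 * P (⋃ k, G k ∩ F k) := by
        rw [ENNReal.tsum_mul_left, measure_iUnion (fun i j hij => (hdisj hij).mono
          Set.inter_subset_right Set.inter_subset_right) fun k => (hGm k).inter (hFm k)]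
    _ ≤ _ := by
        gcongr
        refine Set.iUnion_subset fun k ω hω => ⟨⌈k / ((m : ℝ) + 1)⌉₊, ?_⟩
        have h1 : -(K : ℝ) ≤ X (a k) ω - X (-(⌈k / ((m : ℝ) + 1)⌉₊ : ℝ)) ω := hω.1
        linarith [hω.2.1]

/-- Right-continuity reduces low values in the past to lattices of vanishing mesh, and Ottaviani's
inequality reduces these to integer times, where divergence to `+∞` gives a lower bound. -/
theorem IsTwoSidedLevyProcess.ae_exists_forall_le (hX : IsTwoSidedLevyProcess X P)
    (htop : ∀ᵐ ω ∂P, Tendsto (fun n : ℕ => X (-(n : ℝ)) ω) atTop atTop) :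
    ∀ᵐ ω ∂P, ∃ c, ∀ s ≤ 0, c ≤ X s ω := by
  obtain ⟨K, hK⟩ := hX.exists_half_le_measure
  have hm := hX.measurable
  let L : ℕ → Set Ω := fun c => {ω | ∃ n : ℕ, X (-(n : ℝ)) ω - X 0 ω < -c + K}
  have hbad : ∀ c : ℕ, P {ω | ∃ s ≤ 0, X s ω - X 0 ω < -c} ≤ 2 * P (L c) := by
    intro c
    refine measure_le_of_forall_eventually_mem ?_ fun m => hX.measure_lattice_le hK c m
    rintro ω ⟨s, hs, hlt⟩
    have hs0 : s < 0 := lt_of_le_of_ne hs fun h => by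
      rw [h, sub_self] at hlt
      linarith [(Nat.cast_nonneg c : (0 : ℝ) ≤ c)]
    have h1 : Tendsto (fun m => X (upperApprox m s) ω - X 0 ω) atTop (𝓝 (X s ω - X 0 ω)) :=
      ((hX.cadlag ω s).1.tendsto.comp (tendsto_upperApprox s)).sub_const _
    filter_upwards [h1.eventually (gt_mem_nhds hlt)] with m hm
    -- As `s < 0`, the lattice point above `s` is at most `0`, hence of the form `-k / (m + 1)` with
    -- `k` natural.
    have h2 : ⌊((m : ℝ) + 1) * s⌋ < 0 := Int.floor_lt.2 (by
      rw [Int.cast_zero]; exact mul_neg_of_pos_of_neg (by positivity) hs0)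
    obtain ⟨k, hk⟩ := Int.eq_ofNat_of_zero_le (show 0 ≤ -(⌊((m : ℝ) + 1) * s⌋ + 1) by omega)
    refine ⟨k, ?_⟩
    have h3 : -((k : ℝ) / ((m : ℝ) + 1)) = upperApprox m s := by
      have : (k : ℝ) = -((⌊((m : ℝ) + 1) * s⌋ : ℝ) + 1) := by exact_mod_cast hk.symm
      rw [upperApprox, this]
      ring
    rw [h3]
    exact hm
  have hL0 : P (⋂ c, L c) = 0 := by
    rw [← compl_compl (⋂ c, L c), ← mem_ae_iff]
    filter_upwards [htop] with ω hω hmem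
    obtain ⟨b, hb⟩ := bddBelow_range_of_tendsto_atTop_atTop hω
    obtain ⟨c, hc⟩ := exists_nat_ge (X 0 ω - b + K)
    obtain ⟨n, hn⟩ := Set.mem_iInter.1 hmem c
    linarith [hb (Set.mem_range_self n)]
  have hLlim : Tendsto (fun c => 2 * P (L c)) atTop (𝓝 0) := by
    have h := tendsto_measure_iInter_atTop (μ := P) (s := L)
      (fun c => (measurableSet_exists fun n =>
        measurableSet_lt ((hm _).sub (hm _)) measurable_const).nullMeasurableSet)
      (fun c c' hc ω hω => by
        obtain ⟨n, hn⟩ := hω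
        have : (c : ℝ) ≤ c' := by exact_mod_cast hc
        exact ⟨n, by linarith⟩) ⟨0, measure_ne_top _ _⟩
    rw [hL0] at h
    simpa using ENNReal.Tendsto.const_mul h (Or.inr ENNReal.ofNat_ne_top)
  have hzero : P {ω | ¬ ∃ c, ∀ s ≤ 0, c ≤ X s ω} = 0 := by
    refine le_antisymm (ge_of_tendsto hLlim (Eventually.of_forall fun c => ?_)) bot_le
    refine (measure_mono fun ω hω => ?_).trans (hbad c)
    by_contra hcon
    refine hω ⟨X 0 ω - c, fun s hs => ?_⟩
    by_contra! hlt
    exact hcon ⟨s, hs, by linarith⟩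
  exact ae_iff.2 hzero

end

/-! ### The contact set as a random closed set -/

theorem mem_contactCloseds {α : ℝ} {f : ℝ → ℝ} {hf : IsCadlag f} {t : ℝ} :
    t ∈ contactCloseds α f hf ↔ t ∈ contactSet α f := Iff.rfl

/-- The contact set is a measurable function of the path. -/
theorem exists_measurableSet_contactCloseds_mem {A : Set (Closeds ℝ)} (hA : MeasurableSet A) :
    ∃ B : Set (ℝ → ℝ), MeasurableSet B ∧
      ∀ f (hf : IsCadlag f), f ∈ B ↔ contactCloseds 0 f hf ∈ A := by
  have hm : ∀ t : ℝ, Measurable fun f : {f : ℝ → ℝ // IsCadlag f} => f.1 t := fun t =>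
    (measurable_pi_apply t).comp measurable_subtype_coe
  have h : Measurable fun f : {f : ℝ → ℝ // IsCadlag f} => contactCloseds 0 f.1 f.2 :=
    measurable_closeds_of_nextPoint_lt fun t u =>
      measurableSet_nextPoint_contactCloseds_lt (Z := fun t (f : {f : ℝ → ℝ // IsCadlag f}) => f.1 t)
        (fun f => f.2) (fun r s _ _ => (hm r).sub (hm s)) le_rfl
  obtain ⟨B, hB, hBA⟩ := h hA
  exact ⟨B, hB, fun f hf => Set.ext_iff.1 hBA ⟨f, hf⟩⟩

theorem measurable_shift_zero : Measurable (shift 0) := by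
  refine Measurable.subtype_mk (f := fun w => (shift 0 w).1) ?_
  refine measurable_closeds_of_nextPoint_lt fun s u => ?_
  have : {w | nextPoint s (shift 0 w).1 < u} = {w | nextPoint (0 + max s 0) w < ((0 + u : ℝ) : EReal)} := by
    ext w
    exact nextPoint_shift_lt_coe_iff.trans nextPoint_lt_coe_iff.symm
  rw [this]
  exact measurable_nextPoint _ measurableSet_Iio

/-- The contact set after the next point, when there is no upward jump at this point. -/
theorem IsCadlag.shiftNext_contactCloseds {f : ℝ → ℝ} (hf : IsCadlag f) {t D : ℝ}
    (hD : nextPoint t (contactCloseds 0 f hf) = D) (hjump : f D ≤ Function.leftLim f D) :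
    shiftNext t (contactCloseds 0 f hf) =
      shift 0 (contactCloseds 0 (postPath D f) (isCadlag_postPath hf D)) := by
  have hmem : D ∈ contactSet 0 f := mem_of_nextPoint_eq hD
  rw [shiftNext, if_neg (by rw [hD]; exact EReal.coe_ne_top D), hD, EReal.toReal_coe]
  refine Subtype.ext (SetLike.coe_injective (congrArg closure ?_))
  ext s
  simp only [Set.mem_image, Set.mem_inter_iff, SetLike.mem_coe, mem_contactCloseds, Set.mem_Ioi,
    sub_zero, exists_eq_right]
  constructor
  · rintro ⟨v, ⟨hv, hDv⟩, rfl⟩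
    refine ⟨?_, sub_pos.2 hDv⟩
    rw [hf.mem_contactSet_postPath_iff hmem hjump (sub_pos.2 hDv), add_sub_cancel]
    exact hv
  · rintro ⟨h1, h2⟩
    rw [hf.mem_contactSet_postPath_iff hmem hjump h2] at h1
    exact ⟨D + s, ⟨h1, by linarith⟩, add_sub_cancel_left D s⟩

/-! ### Stationarity and regeneration of the contact set -/

variable {Ω : Type*} [MeasurableSpace Ω] {P : Measure Ω} {X : ℝ → Ω → ℝ}

theorem IsTwoSidedLevyProcess.measurable_contactCloseds (hX : IsTwoSidedLevyProcess X P) :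
    Measurable fun ω => contactCloseds 0 (fun t => X t ω) (hX.cadlag ω) :=
  measurable_closeds_of_nextPoint_lt fun _ _ =>
    measurableSet_nextPoint_contactCloseds_lt hX.cadlag
      (fun r s _ _ => (hX.measurable r).sub (hX.measurable s)) le_rfl

theorem IsTwoSidedLevyProcess.add_drift (hX : IsTwoSidedLevyProcess X P) (c : ℝ) :
    IsTwoSidedLevyProcess (fun t ω => X t ω + c * t) P where
  measurable t := (hX.measurable t).add_const _
  cadlag ω := (hX.cadlag ω).add_continuous (by fun_prop)
  indep_increments n t ht := by
    have h := (hX.indep_increments n t ht).comp (fun i x => x + c * (t i.succ - t i.castSucc))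
      (fun i => by fun_prop)
    convert h using 2 with i
    ext ω
    simp only [Function.comp_apply]
    ring
  stationary_increments s t h hst := by
    have hm := hX.measurable
    have key := congrArg (Measure.map fun x : ℝ => x + c * (t - s))
      (hX.stationary_increments s t h hst)
    rw [Measure.map_map (by fun_prop) (by fun_prop), Measure.map_map (by fun_prop) (by fun_prop)]
      at key
    convert key using 2 <;>
    · ext ω
      simp only [Function.comp_apply]
      ring
  zero := by
    filter_upwards [hX.zero] with ω hω
    rw [hω, mul_zero, add_zero]

variable [IsProbabilityMeasure P]

theorem IsTwoSidedLevyProcess.isStationaryLaw (hX : IsTwoSidedLevyProcess X P) :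
    IsStationaryLaw (P.map fun ω => contactCloseds 0 (fun t => X t ω) (hX.cadlag ω)) := by
  intro u
  have hH := hX.measurable_contactCloseds
  have hm := hX.measurable
  rw [Measure.map_map (measurable_translate u) hH]
  ext A hA
  rw [Measure.map_apply ((measurable_translate u).comp hH) hA, Measure.map_apply hH hA]
  obtain ⟨B, hB, hBA⟩ := exists_measurableSet_contactCloseds_mem hA
  have hcad : ∀ h ω, IsCadlag fun s => X (h + s) ω - X h ω := fun h ω => by
    simpa [sub_eq_add_neg] using
      ((hX.cadlag ω).comp_const_add h).add_continuous (continuous_const (y := -X h ω))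
  have h1 : ∀ ω, translate u (contactCloseds 0 (fun t => X t ω) (hX.cadlag ω)) =
      contactCloseds 0 (fun s => X (-u + s) ω - X (-u) ω) (hcad (-u) ω) := fun ω => by
    refine SetLike.ext fun t => ?_
    rw [mem_contactCloseds, contactSet_comp_const_add (hX.cadlag ω), neg_add_eq_sub]
    rfl
  have h2 : ∀ ω, contactCloseds 0 (fun t => X t ω) (hX.cadlag ω) =
      contactCloseds 0 (fun s => X (0 + s) ω - X 0 ω) (hcad 0 ω) := fun ω => by
    refine SetLike.ext fun t => ?_
    rw [mem_contactCloseds, mem_contactCloseds, contactSet_comp_const_add (hX.cadlag ω), zero_add]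
  have hpath : ∀ h, (fun ω s => X (h + s) ω - X h ω) ⁻¹' B =
      {ω | contactCloseds 0 (fun s => X (h + s) ω - X h ω) (hcad h ω) ∈ A} := fun h => by
    ext ω
    exact hBA _ (hcad h ω)
  have e1 : (translate u ∘ fun ω => contactCloseds 0 (fun t => X t ω) (hX.cadlag ω)) ⁻¹' A =
      (fun ω s => X (-u + s) ω - X (-u) ω) ⁻¹' B := by
    rw [hpath]
    ext ω
    simp only [Set.mem_preimage, Function.comp_apply, Set.mem_ofPred_eq, h1]
  have e2 : (fun ω => contactCloseds 0 (fun t => X t ω) (hX.cadlag ω)) ⁻¹' A =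
      (fun ω s => X (0 + s) ω - X 0 ω) ⁻¹' B := by
    rw [hpath]
    ext ω
    simp only [Set.mem_preimage, Set.mem_ofPred_eq]
    rw [h2]
  rw [e1, e2, ← Measure.map_apply (by fun_prop) hB, ← Measure.map_apply (by fun_prop) hB,
    hX.map_increments, hX.map_increments]

/-- The part of the contact set after the next point is independent of the past, and its law does
not depend on the time. -/
theorem IsTwoSidedLevyProcess.exists_measure_inter_shiftNext (hX : IsTwoSidedLevyProcess X P)
    (hfin : ∀ᵐ ω ∂P, ∀ t, nextPoint t (contactCloseds 0 (fun t => X t ω) (hX.cadlag ω)) ≠ ⊤)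
    {C : Set NonnegCloseds} (hC : MeasurableSet C) :
    ∃ p : ENNReal, ∀ t, ∀ A : Set (Closeds ℝ), MeasurableSet[sigmaUpToPlus t] A →
      P {ω | contactCloseds 0 (fun t => X t ω) (hX.cadlag ω) ∈ A ∧
        shiftNext t (contactCloseds 0 (fun t => X t ω) (hX.cadlag ω)) ∈ C} =
      P {ω | contactCloseds 0 (fun t => X t ω) (hX.cadlag ω) ∈ A} * p := by
  obtain ⟨B, hB, hBC⟩ := exists_measurableSet_contactCloseds_mem (measurable_shift_zero hC)
  -- The constant is the probability that the path restarted at time `0` has a contact set whose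
  -- positive part lies in `C`; it involves neither `t` nor `A`.
  refine ⟨P {ω | postPath 0 (fun t => X t ω) ∈ B}, fun t A hA => ?_⟩
  set H : Ω → Closeds ℝ := fun ω => contactCloseds 0 (fun t => X t ω) (hX.cadlag ω) with hHdef
  have hnext : ∀ u s x : ℝ, x ≤ u →
      MeasurableSet[pastSigma X u] {ω | nextPoint s (H ω) < x} := fun u s x hx =>
    measurableSet_nextPoint_contactCloseds_lt (m := pastSigma X u) hX.cadlag
      (fun r s hr hs => measurable_sub_pastSigma X hr hs) hx
  have hSM := hX.strongMarkov_ereal (T := fun ω => nextPoint t (H ω)) (E := H ⁻¹' A)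
    (fun ω => ((EReal.bot_lt_coe t).trans_le (le_nextPoint t _)).ne')
    ((measurable_nextPoint t).comp hX.measurable_contactCloseds)
    (fun u => measurableSet_preimage_inter_of_sigmaUpToPlus (hnext u) hA) hB
  have h1 : P {ω | H ω ∈ A ∧ shiftNext t (H ω) ∈ C} = P ((H ⁻¹' A ∩ {ω | nextPoint t (H ω) ≠ ⊤}) ∩
      {ω | postPath (nextPoint t (H ω)).toReal (fun t => X t ω) ∈ B}) := by
    refine measure_congr ?_
    filter_upwards [hfin, hX.ae_le_leftLim_nextPoint t] with ω hω hjump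
    obtain ⟨D, hD⟩ := exists_nextPoint_eq_coe (hω t)
    have hD' : nextPoint t (H ω) = D := hD
    refine propext ?_
    change (H ω ∈ A ∧ shiftNext t (H ω) ∈ C) ↔ ((H ω ∈ A ∧ nextPoint t (H ω) ≠ ⊤) ∧
      postPath (nextPoint t (H ω)).toReal (fun t => X t ω) ∈ B)
    rw [hD', EReal.toReal_coe, hBC _ (isCadlag_postPath (hX.cadlag ω) D), Set.mem_preimage,
      ← (hX.cadlag ω).shiftNext_contactCloseds hD (hjump D hD)]
    exact ⟨fun h => ⟨⟨h.1, EReal.coe_ne_top D⟩, h.2⟩, fun h => ⟨h.1.1, h.2⟩⟩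
  have h2 : P (H ⁻¹' A ∩ {ω | nextPoint t (H ω) ≠ ⊤}) = P {ω | H ω ∈ A} := by
    refine measure_congr ?_
    filter_upwards [hfin] with ω hω
    exact propext ⟨fun h => h.1, fun h => ⟨h, hω t⟩⟩
  rw [h1, hSM, h2]

/-- The regeneration law is that of `shiftNext 0`: taking `t = 0` and the sure event identifies the
constant of the product formula, which then says that the conditional expectation is constant. -/
theorem IsTwoSidedLevyProcess.isRegenerativeLaw (hX : IsTwoSidedLevyProcess X P)
    (hfin : ∀ᵐ ω ∂P, ∀ t, nextPoint t (contactCloseds 0 (fun t => X t ω) (hX.cadlag ω)) ≠ ⊤) :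
    IsRegenerativeLaw (P.map fun ω => contactCloseds 0 (fun t => X t ω) (hX.cadlag ω)) := by
  have hH := hX.measurable_contactCloseds
  set Q := P.map fun ω => contactCloseds 0 (fun t => X t ω) (hX.cadlag ω) with hQ
  have hQprob : IsProbabilityMeasure Q := Measure.isProbabilityMeasure_map hH.aemeasurable
  have key : ∀ t, ∀ A : Set (Closeds ℝ), MeasurableSet[sigmaUpToPlus t] A →
      (Q.restrict A).map (shiftNext t) = Q A • Q.map (shiftNext 0) := by
    intro t A hA
    have hA' : MeasurableSet A := sigmaUpToPlus_le t A hA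
    ext C hC
    obtain ⟨p, hp⟩ := hX.exists_measure_inter_shiftNext hfin hC
    have h0 := hp 0 Set.univ MeasurableSet.univ
    have h1 := hp t A hA
    simp only [Set.mem_univ, true_and, Set.ofPred_true, measure_univ, one_mul] at h0
    rw [Measure.map_apply (measurable_shiftNext t) hC,
      Measure.restrict_apply (measurable_shiftNext t hC), Measure.smul_apply, smul_eq_mul,
      Measure.map_apply (measurable_shiftNext 0) hC, hQ, Measure.map_apply hH hA',
      Measure.map_apply hH (measurable_shiftNext 0 hC),
      Measure.map_apply hH ((measurable_shiftNext t hC).inter hA'), Set.inter_comm]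
    refine h1.trans ?_
    rw [← h0]
    rfl
  refine ⟨Q.map (shiftNext 0), hQprob,
    Measure.isProbabilityMeasure_map (measurable_shiftNext 0).aemeasurable, fun t => ?_,
    fun t F hF => ?_⟩
  · have hS : MeasurableSet {w | nextPoint t w = ⊤} :=
      measurable_nextPoint t (measurableSet_singleton ⊤)
    rw [hQ, Measure.map_apply hH hS]
    exact measure_mono_null (t := {ω | ¬ ∀ t, nextPoint t (contactCloseds 0 (fun t => X t ω)
      (hX.cadlag ω)) ≠ ⊤}) (fun ω hω hcon => hcon t hω) (ae_iff.1 hfin)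
  · have hF' : Measurable fun v : NonnegCloseds => F v.1 := hF.comp measurable_subtype_coe
    refine (ae_eq_condLExp (hm := sigmaUpToPlus_le t) Q _ measurable_const fun A hA => ?_).symm
    rw [setLIntegral_const, ← lintegral_map (f := fun v : NonnegCloseds => F v.1) hF'
      (measurable_shiftNext t), key t A hA, lintegral_smul_measure, smul_eq_mul, mul_comm]

theorem IsTwoSidedLevyProcess.ae_nextPoint_ne_top (hX : IsTwoSidedLevyProcess X P)
    (hbot : ∀ᵐ ω ∂P, Tendsto (fun n : ℕ => X n ω) atTop atBot)
    (htop : ∀ᵐ ω ∂P, Tendsto (fun n : ℕ => X (-(n : ℝ)) ω) atTop atTop) :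
    ∀ᵐ ω ∂P, ∀ t, nextPoint t (contactCloseds 0 (fun t => X t ω) (hX.cadlag ω)) ≠ ⊤ := by
  filter_upwards [hbot, hX.ae_exists_forall_le htop] with ω h1 h2 t
  obtain ⟨s, hs, hts⟩ := (hX.cadlag ω).exists_mem_contactSet_gt h1 h2 t
  exact ((nextPoint_le (w := contactCloseds 0 (fun t => X t ω) (hX.cadlag ω)) hs hts).trans_lt
    (EReal.coe_lt_top s)).ne

end RegenerativeSet

theorem mainTheorem3 {Ω : Type*} [MeasurableSpace Ω] (P : Measure Ω) [IsProbabilityMeasure P]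
    (X : ℝ → Ω → ℝ) (hX : RegenerativeSet.IsTwoSidedLevyProcess X P)
    (hpos : ∫⁻ ω, ENNReal.ofReal (X 1 ω) ∂P < ⊤)
    (α : ℝ) (hα : RegenerativeSet.extendedExpectation (X 1) P < (α : EReal))
    (H : Ω → Closeds ℝ)
    (hH : H = fun ω => RegenerativeSet.contactCloseds α (fun t => X t ω) (hX.cadlag ω)) :
    Measurable H ∧
    RegenerativeSet.IsStationaryLaw (P.map H) ∧
    RegenerativeSet.IsRegenerativeLaw (P.map H) ∧
    ∀ᵐ ω ∂P, ∃ D : ℝ, RegenerativeSet.nextPoint 0 (H ω) = (D : EReal) ∧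
      X D ω ≤ Function.leftLim (fun t => X t ω) D := by
  have hY := hX.add_drift (-α)
  have hHY : H = fun ω => RegenerativeSet.contactCloseds 0 (fun t => X t ω + -α * t)
      (hY.cadlag ω) := by
    rw [hH]
    ext1 ω
    exact SetLike.coe_injective (RegenerativeSet.contactSet_eq_contactSet_zero (hX.cadlag ω) α)
  have hfin := hY.ae_nextPoint_ne_top (hX.ae_tendsto_atBot hpos hα) (hX.ae_tendsto_atTop hpos hα)
  rw [hHY]
  refine ⟨hY.measurable_contactCloseds, hY.isStationaryLaw, hY.isRegenerativeLaw hfin, ?_⟩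
  filter_upwards [hfin, hY.ae_le_leftLim_nextPoint 0] with ω h1 h2
  obtain ⟨D, hD⟩ := RegenerativeSet.exists_nextPoint_eq_coe (h1 0)
  have h3 := h2 D hD
  -- The drift is continuous, so it cancels in the comparison of the value with the left limit.
  rw [(hX.cadlag ω).leftLim_add_continuous (by fun_prop)] at h3
  exact ⟨D, hD, by linarith⟩
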